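/- Let $K$ be an algebraically closed field of characteristic $0$. For a finite-dimensional Lie algebra $\mathfrak g$ over $K$, its index is $\operatorname{ind}\mathfrak g=\min_{f\in\mathfrak g^*}\dim\ker B_f$, where $B_f(x,y)=f([x,y])$. For compositions $a=(a_1,\dots,a_m)$ and $b=(b_1,\dots,b_t)$ of $n\ge 1$, the seaweed algebra of type $\frac{a_1|\cdots|a_m}{b_1|\cdots|b_t}$ is the Lie subalgebra of $\mathfrak{sl}(n)=\mathfrak{sl}(n,K)$ consisting of all traceless matrices that preserve each of the subspaces $V_i=\operatorname{span}\{e_1,\dots,e_{a_1+\cdots+a_i}\}$ ($0\le i\le m$) and $W_j=\operatorname{span}\{e_{b_1+\cdots+b_j+1},\dots,e_n\}$ ($0\le j\le t$) of $K^n$, where $e_1,\dots,e_n$ is the standard basis. For $k\in\mathbb Z$, let $C(n,k)$ be the number of ordered pairs $(a,b)$ of compositions of $n$ whose seaweed algebra has index $k$ (so $C(n,k)=0$ for $k<0$). Then, as formal power series over $\mathbb Q$, $$\sum_{n>0}C(n,n-3)\,x^n=\frac{6x^3-10x^4-4x^5+10x^6-4x^7}{(1-2x)^3}.$$ -/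

import Mathlib

open scoped PowerSeries

namespace Seaweed

noncomputable section

/-- The Kirillov form `B_f(x, y) = f ⁅x, y⁆` attached to a linear form `f` on a Lie algebra. -/
def kirillovForm (K : Type*) {L : Type*} [Field K] [LieRing L] [LieAlgebra K L]
    (f : Module.Dual K L) : L →ₗ[K] L →ₗ[K] K :=
  LinearMap.mk₂ K (fun x y => f ⁅x, y⁆)
    (fun x₁ x₂ y => by rw [add_lie, map_add])
    (fun c x y => by rw [smul_lie, map_smul])
    (fun x y₁ y₂ => by rw [lie_add, map_add])
    (fun c x y => by rw [lie_smul, map_smul])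

/-- The index of a (finite-dimensional) Lie algebra `L`: the minimum over all linear forms `f`
of the dimension of the kernel `{x | ∀ y, f ⁅x, y⁆ = 0}` of the Kirillov form `B_f`. -/
def index (K L : Type*) [Field K] [LieRing L] [LieAlgebra K L] : ℕ :=
  sInf (Set.range fun f : Module.Dual K L =>
    Module.finrank K (LinearMap.ker (kirillovForm K f)))

/-- The minimum in the definition of the index is attained. -/
theorem index_isLeast (K L : Type*) [Field K] [LieRing L] [LieAlgebra K L] :
    IsLeast (Set.range fun f : Module.Dual K L =>
      Module.finrank K (LinearMap.ker (kirillovForm K f))) (index K L) :=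
  ⟨Nat.sInf_mem (Set.range_nonempty _), fun _ h => Nat.sInf_le h⟩

/-- `V_i`, the span of the first `a_1 + ⋯ + a_i` standard basis vectors of `K ^ n`. -/
def upperFlag (K : Type*) [Field K] {n : ℕ} (a : Composition n) (i : ℕ) :
    Submodule K (Fin n → K) :=
  Submodule.span K {v | ∃ k : Fin n, (k : ℕ) < a.sizeUpTo i ∧ v = Pi.single k 1}

/-- `W_j`, the span of the standard basis vectors of `K ^ n` after the first
`b_1 + ⋯ + b_j` ones. -/
def lowerFlag (K : Type*) [Field K] {n : ℕ} (b : Composition n) (j : ℕ) :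
    Submodule K (Fin n → K) :=
  Submodule.span K {v | ∃ k : Fin n, b.sizeUpTo j ≤ (k : ℕ) ∧ v = Pi.single k 1}

/-- Matrices preserving a subspace are closed under commutators. -/
theorem lie_mulVec_mem {K : Type*} [Field K] {n : ℕ} {A B : Matrix (Fin n) (Fin n) K}
    {U : Submodule K (Fin n → K)} (hA : ∀ v ∈ U, A.mulVec v ∈ U)
    (hB : ∀ v ∈ U, B.mulVec v ∈ U) : ∀ v ∈ U, (A * B - B * A).mulVec v ∈ U := by
  intro v hv
  rw [Matrix.sub_mulVec, ← Matrix.mulVec_mulVec, ← Matrix.mulVec_mulVec]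
  exact U.sub_mem (hA _ (hB _ hv)) (hB _ (hA _ hv))

/-- The seaweed algebra of type `a_1|⋯|a_m / b_1|⋯|b_t`: the Lie subalgebra of `sl(n)` of all
traceless matrices which preserve every `V_i` and every `W_j`.  (For `i` beyond the number of
parts, `V_i` is the whole space and `W_i` is zero.) -/
def seaweed (K : Type*) [Field K] {n : ℕ} (a b : Composition n) :
    LieSubalgebra K (LieAlgebra.SpecialLinear.sl (Fin n) K) where
  carrier := {A | (∀ i, ∀ v ∈ upperFlag K a i, A.val.mulVec v ∈ upperFlag K a i) ∧
    (∀ j, ∀ v ∈ lowerFlag K b j, A.val.mulVec v ∈ lowerFlag K b j)}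
  add_mem' := by
    rintro A B ⟨hA, hA'⟩ ⟨hB, hB'⟩
    refine ⟨fun i v hv => ?_, fun j v hv => ?_⟩
    · have h := (upperFlag K a i).add_mem (hA i v hv) (hB i v hv)
      rwa [← Matrix.add_mulVec] at h
    · have h := (lowerFlag K b j).add_mem (hA' j v hv) (hB' j v hv)
      rwa [← Matrix.add_mulVec] at h
  zero_mem' := by
    refine ⟨fun i v _ => ?_, fun j v _ => ?_⟩
    · have h := (upperFlag K a i).zero_mem
      rwa [← Matrix.zero_mulVec v] at h
    · have h := (lowerFlag K b j).zero_mem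
      rwa [← Matrix.zero_mulVec v] at h
  smul_mem' := by
    rintro c A ⟨hA, hA'⟩
    refine ⟨fun i v hv => ?_, fun j v hv => ?_⟩
    · have h := (upperFlag K a i).smul_mem c (hA i v hv)
      rwa [← Matrix.smul_mulVec] at h
    · have h := (lowerFlag K b j).smul_mem c (hA' j v hv)
      rwa [← Matrix.smul_mulVec] at h
  lie_mem' := by
    rintro A B ⟨hA, hA'⟩ ⟨hB, hB'⟩
    exact ⟨fun i => lie_mulVec_mem (hA i) (hB i), fun j => lie_mulVec_mem (hA' j) (hB' j)⟩

/-- `C(n, k)`: the number of ordered pairs of compositions of `n` for which the associated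
seaweed subalgebra of `sl(n)` over `K` has index `k`.  The argument `k` is an integer, so that
`C(n, n - 3)` is meaningful (and zero) for `n < 3`. -/
def numPairs (K : Type*) [Field K] (n : ℕ) (k : ℤ) : ℕ :=
  Nat.card {p : Composition n × Composition n // (index K (seaweed K p.1 p.2) : ℤ) = k}

end

end Seaweed

/-!
Scalar matrices split off, so the index of a seaweed algebra in `sl(n)` is one less than the index
of the corresponding algebra in `gl(n)` (`index_seaweed_add_one`).  The latter is a *pattern
algebra*: it consists of all matrices supported on a transitive set of positions
(`mem_seaweed_iff`).  Every linear form on it is `x ↦ tr (F x)` for a matrix `F`, so its index is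
the least dimension, over all `F`, of the radical of `(x, y) ↦ tr (F [x, y])` on the pattern.

The index in `gl(n)` obeys a recursion due to Panyushev.  Suppose that the first parts satisfy
`a₁ < b₁`, let `A` be the set of the first `a₁` positions, `C` that of the following `b₁ - a₁`
ones, and `m = min (a₁, b₁ - a₁)`.  The positions `A × C` form an abelian ideal.  A generic form
can be moved, by units of the algebra, to one whose restriction to this ideal is a partial identity
of rank `m` (`IsReduction.exists_conj_normalForm`).  For such a form the ideal is isotropic and
meets the radical trivially, and its orthogonal space modulo the ideal is again a pattern algebra,
on `n - m` positions.  Hence the radicals of the two forms have the same dimension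
(`finrank_ker_eq_of_isotropic`), and as it suffices to look at generic forms
(`exists_finrank_ker_add_smul_le`), both algebras have the same index
(`IsReduction.patternIndex_eq`).  The algebra that remains is again a seaweed algebra
(`glIndex_reduce_small`, `glIndex_reduce_large`).  If `a₁ = b₁ = c`, then `gl(c)`, which has index
`c` (`patternIndex_true`), splits off as a direct summand (`glIndex_cons_self`).

For the *defect* `n - ind` this means: an equal first part can be removed without changing the
defect, and otherwise the reduction lowers it by `m ≥ 1`.  So the defect is zero exactly if `a = b`
(`defect_eq_zero_iff`), and a pair of defect `k` with `a₁ < b₁` arises, in one of three ways, from a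
pair of smaller defect (`mem_lower_iff`).  This describes all pairs of defect one (`lower_one`) and
two (`lower_two`) explicitly and gives their generating functions.  Since the index in `sl(n)` is
`n - 1` minus the defect, `C(n, n - 3)` counts the pairs of defect two.
-/

set_option linter.unusedSectionVars false
set_option linter.unusedSimpArgs false

namespace Seaweed

/-! ### Radicals of bilinear forms -/

section Radical

open Module Matrix

variable {K V U : Type*} [Field K] [AddCommGroup V] [Module K V] [AddCommGroup U] [Module K U]

/-- The dimension of the radical is invariant under isometries up to a nonzero factor. -/
theorem finrank_ker_eq_of_equiv {B : V →ₗ[K] V →ₗ[K] K} {B' : U →ₗ[K] U →ₗ[K] K}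
    (φ : V ≃ₗ[K] U) {c : K} (hc : c ≠ 0) (h : ∀ x y, B' (φ x) (φ y) = c * B x y) :
    finrank K (LinearMap.ker B) = finrank K (LinearMap.ker B') := by
  have hmap : (LinearMap.ker B).map (φ : V →ₗ[K] U) = LinearMap.ker B' := by
    ext z
    obtain ⟨x, rfl⟩ := φ.surjective z
    rw [show φ x = (φ : V →ₗ[K] U) x from rfl,
      Submodule.mem_map_equiv, LinearMap.mem_ker, LinearMap.mem_ker]
    simp only [LinearEquiv.coe_coe, LinearEquiv.symm_apply_apply]
    constructor
    · intro hx
      ext w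
      obtain ⟨y, rfl⟩ := φ.surjective w
      rw [h, hx]
      simp
    · intro hx
      ext y
      have := h x y
      rw [hx] at this
      simpa [hc] using this.symm
  rw [← hmap]
  exact (LinearEquiv.finrank_eq (φ.submoduleMap _))

/-- Reduction of a form along an isotropic subspace `W` that meets the radical trivially: if
`ψ` identifies `U` isometrically with a complement of `W` in its orthogonal space, then the
radicals of both forms have the same dimension. -/
theorem finrank_ker_eq_of_isotropic [FiniteDimensional K V] [FiniteDimensional K U]
    {B : V →ₗ[K] V →ₗ[K] K} {B' : U →ₗ[K] U →ₗ[K] K}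
    (hB : ∀ x y, B x y = -B y x) (W : Submodule K V) (hW : ∀ x ∈ W, ∀ y ∈ W, B x y = 0)
    (hrad : ∀ x ∈ W, (∀ y, B x y = 0) → x = 0)
    (ψ : U →ₗ[K] V) (hψ : ∀ s t, B (ψ s) (ψ t) = B' s t)
    (hψW : ∀ s, ∀ y ∈ W, B (ψ s) y = 0) (hdisj : ∀ s, ψ s ∈ W → s = 0)
    (hsup : ∀ x, (∀ y ∈ W, B x y = 0) → ∃ s, x - ψ s ∈ W) :
    finrank K (LinearMap.ker B) = finrank K (LinearMap.ker B') := by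
  have hsym : ∀ {x y}, B x y = 0 → B y x = 0 := fun {x y} h => by rw [hB, h, neg_zero]
  let P := LinearMap.BilinForm.orthogonal B W
  have memP : ∀ x, x ∈ P ↔ ∀ y ∈ W, B x y = 0 := fun x => by
    simp only [P, LinearMap.BilinForm.mem_orthogonal_iff]
    exact ⟨fun h y hy => hsym (h y hy), fun h y hy => hsym (h y hy)⟩
  let Q := LinearMap.BilinForm.orthogonal B P
  have memQ : ∀ x, x ∈ Q ↔ ∀ y ∈ P, B x y = 0 := fun x => by
    simp only [Q, LinearMap.BilinForm.mem_orthogonal_iff]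
    exact ⟨fun h y hy => hsym (h y hy), fun h y hy => hsym (h y hy)⟩
  have hWP : W ≤ P := fun x hx => (memP x).2 fun y hy => hW x hx y hy
  have hkerP : LinearMap.ker B ≤ P := fun x hx => (memP x).2 fun y _ => by
    rw [LinearMap.mem_ker.1 hx]; rfl
  have h1 := LinearMap.BilinForm.finrank_add_finrank_orthogonal' (B := B) W
  have h2 := LinearMap.BilinForm.finrank_add_finrank_orthogonal' (B := B) P
  have e1 : W ⊓ LinearMap.ker B = ⊥ := by
    rw [eq_bot_iff]
    rintro x ⟨hx, hx'⟩
    exact hrad x hx fun y => by rw [LinearMap.mem_ker.1 hx']; rfl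
  have e2 : P ⊓ LinearMap.ker B = LinearMap.ker B := inf_eq_right.2 hkerP
  change finrank K W + finrank K P = _ at h1
  change finrank K P + finrank K Q = _ at h2
  rw [e1, finrank_bot] at h1
  rw [e2] at h2
  have hinj : Function.Injective ψ := by
    rw [← LinearMap.ker_eq_bot, eq_bot_iff]
    intro s hs
    exact hdisj s (by rw [LinearMap.mem_ker.1 hs]; exact W.zero_mem)
  have hQ : Q = W ⊔ (LinearMap.ker B').map ψ := by
    apply le_antisymm
    · intro x hx
      have hxP : x ∈ P := (memP x).2 fun y hy => (memQ x).1 hx y (hWP hy)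
      obtain ⟨s, hs⟩ := hsup x ((memP x).1 hxP)
      refine Submodule.mem_sup.2 ⟨_, hs, ψ s, ⟨s, ?_, rfl⟩, by abel⟩
      rw [SetLike.mem_coe, LinearMap.mem_ker]
      ext t
      rw [← hψ]
      have ht : ψ t ∈ P := (memP _).2 (hψW t)
      have h3 := (memQ x).1 hx _ ht
      have h4 : B (x - ψ s) (ψ t) = 0 := hsym ((memP _).1 ht _ hs)
      rw [map_sub, LinearMap.sub_apply, h3, zero_sub, neg_eq_zero] at h4
      simpa using h4
    · refine sup_le (fun x hx => (memQ x).2 fun y hy => hsym ((memP y).1 hy x hx)) ?_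
      rintro _ ⟨s, hs, rfl⟩
      refine (memQ _).2 fun y hy => ?_
      obtain ⟨t, ht⟩ := hsup y ((memP y).1 hy)
      have h4 := hψW s _ ht
      rw [map_sub, hψ, LinearMap.mem_ker.1 hs, LinearMap.zero_apply, sub_zero] at h4
      exact h4
  have hdis : W ⊓ (LinearMap.ker B').map ψ = ⊥ := by
    rw [eq_bot_iff]
    rintro _ ⟨hx, s, -, rfl⟩
    rw [hdisj s hx, map_zero]
    exact Submodule.zero_mem _
  have h5 := Submodule.finrank_sup_add_finrank_inf_eq W ((LinearMap.ker B').map ψ)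
  rw [hdis, finrank_bot, ← hQ,
    ← LinearEquiv.finrank_eq (Submodule.equivMapOfInjective ψ hinj (LinearMap.ker B'))] at h5
  omega

/-- Along a line of linear maps, the rank drops below its value at `T₀` in finitely many points
only; so there is a point where it does not drop and where a given polynomial does not vanish. -/
theorem exists_finrank_ker_add_smul_le [Infinite K] [FiniteDimensional K V]
    [FiniteDimensional K U] (T₀ T₁ : V →ₗ[K] U) {p : Polynomial K} (hp : p ≠ 0) :
    ∃ t : K, p.eval t ≠ 0 ∧
      finrank K (LinearMap.ker (T₀ + t • T₁)) ≤ finrank K (LinearMap.ker T₀) := by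
  obtain ⟨C, hC⟩ := Submodule.exists_isCompl (LinearMap.ker T₀)
  -- on a complement `C` of the kernel, `T₀` has a left inverse `q`
  have hinj : LinearMap.ker (T₀ ∘ₗ C.subtype) = ⊥ := by
    rw [eq_bot_iff]
    intro x hx
    have : (x : V) ∈ LinearMap.ker T₀ ⊓ C := ⟨hx, x.2⟩
    rw [hC.inf_eq_bot] at this
    exact Subtype.ext (by simpa using this)
  obtain ⟨q, hq⟩ := LinearMap.exists_leftInverse_of_injective _ hinj
  let b := Module.finBasis K C
  let M : Matrix _ _ K := LinearMap.toMatrix b b (q ∘ₗ T₁ ∘ₗ C.subtype)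
  -- `T₀ + t • T₁` is injective on `C` wherever `d = det (1 + t • M)` does not vanish
  let d : Polynomial K := Matrix.det
    ((1 : Matrix _ _ (Polynomial K)) + (Polynomial.X : Polynomial K) • M.map Polynomial.C)
  have hd : ∀ t, d.eval t = Matrix.det (1 + t • M) := by
    intro t
    simp only [d]
    rw [← Polynomial.coe_evalRingHom, RingHom.map_det]
    congr 1
    ext i j
    simp [Matrix.one_apply, apply_ite]
    exact mul_comm _ _
  have hd0 : d ≠ 0 := by
    intro h
    have := hd 0
    simp [h] at this
  obtain ⟨t, ht⟩ := Polynomial.exists_eval_ne_zero_of_natDegree_lt_card (p * d)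
    (mul_ne_zero hp hd0) ((Cardinal.natCast_lt_aleph0).trans_le (Cardinal.aleph0_le_mk K))
  rw [Polynomial.eval_mul] at ht
  refine ⟨t, left_ne_zero_of_mul ht, ?_⟩
  have hdet := right_ne_zero_of_mul ht
  rw [hd] at hdet
  have hTC : LinearMap.toMatrix b b (q ∘ₗ (T₀ + t • T₁) ∘ₗ C.subtype) = 1 + t • M := by
    rw [LinearMap.add_comp, LinearMap.comp_add, hq, map_add, LinearMap.toMatrix_id,
      LinearMap.smul_comp, LinearMap.comp_smul, map_smul]
  have hC2 : LinearMap.ker (T₀ + t • T₁) ⊓ C = ⊥ := by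
    rw [eq_bot_iff]
    rintro x ⟨hx, hxC⟩
    have h1 : (q ∘ₗ (T₀ + t • T₁) ∘ₗ C.subtype) ⟨x, hxC⟩ = 0 := by
      have h0 : (T₀ + t • T₁) x = 0 := hx
      simp only [LinearMap.comp_apply, Submodule.subtype_apply, h0, map_zero]
    have h2 := LinearMap.toMatrix_mulVec_repr b b (q ∘ₗ (T₀ + t • T₁) ∘ₗ C.subtype) ⟨x, hxC⟩
    rw [h1, hTC, map_zero] at h2
    have h3 := Matrix.eq_zero_of_mulVec_eq_zero hdet h2
    have h4 : (⟨x, hxC⟩ : C) = 0 := by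
      apply b.repr.injective
      rw [map_zero]
      exact DFunLike.coe_injective h3
    simpa using congrArg Subtype.val h4
  have h1 := Submodule.finrank_add_finrank_le_of_disjoint (disjoint_iff.2 hC2)
  have h2 := Submodule.finrank_add_eq_of_isCompl hC
  omega

end Radical

/-! ### Pattern algebras and their index -/

section Pattern

open Module Matrix

variable {K : Type*} [Field K] {ι κ : Type*}

/-- The matrices whose nonzero entries sit at positions `(i, j)` with `R i j`. -/
def patternSpace (K : Type*) [Field K] (R : ι → ι → Prop) : Submodule K (Matrix ι ι K) where
  carrier := {x | ∀ i j, ¬R i j → x i j = 0}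
  add_mem' hx hy i j h := by simp [hx i j h, hy i j h]
  zero_mem' _ _ _ := rfl
  smul_mem' c x hx i j h := by simp [hx i j h]

theorem mem_patternSpace {R : ι → ι → Prop} {x : Matrix ι ι K} :
    x ∈ patternSpace K R ↔ ∀ i j, ¬R i j → x i j = 0 := Iff.rfl

variable [Fintype ι] [Fintype κ]

theorem mul_mem_patternSpace {R : ι → ι → Prop} (hR : ∀ i j k, R i j → R j k → R i k)
    {x y : Matrix ι ι K} (hx : x ∈ patternSpace K R) (hy : y ∈ patternSpace K R) :
    x * y ∈ patternSpace K R := by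
  intro i k hik
  rw [Matrix.mul_apply]
  refine Finset.sum_eq_zero fun j _ => ?_
  by_cases h : R i j
  · rw [hy j k fun h' => hik (hR i j k h h'), mul_zero]
  · rw [hx i j h, zero_mul]

/-- The form `(x, y) ↦ tr (F [x, y])`.  Every linear form on a space of matrices is `x ↦ tr (F x)`
for some matrix `F`, so these are the Kirillov forms of matrix Lie algebras. -/
def commForm (F : Matrix ι ι K) : Matrix ι ι K →ₗ[K] Matrix ι ι K →ₗ[K] K :=
  LinearMap.mk₂ K (fun x y => trace (F * (x * y - y * x)))
    (fun x₁ x₂ y => by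
      rw [← trace_add, ← Matrix.mul_add]; congr 2; noncomm_ring)
    (fun c x y => by
      rw [← trace_smul, ← Matrix.mul_smul, smul_sub, Matrix.smul_mul, Matrix.mul_smul])
    (fun x y₁ y₂ => by
      rw [← trace_add, ← Matrix.mul_add]; congr 2; noncomm_ring)
    (fun c x y => by
      rw [← trace_smul, ← Matrix.mul_smul, smul_sub, Matrix.smul_mul, Matrix.mul_smul])

theorem commForm_apply (F x y : Matrix ι ι K) :
    commForm F x y = trace (F * (x * y - y * x)) := rfl

theorem commForm_antisymm (F x y : Matrix ι ι K) : commForm F x y = -commForm F y x := by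
  rw [commForm_apply, commForm_apply, ← trace_neg, ← Matrix.mul_neg, neg_sub]

/-- So `x` is in the radical of `commForm F` on a pattern space exactly if the commutator of `F` and
`x` is orthogonal to the pattern space under the trace form. -/
theorem commForm_eq (F x y : Matrix ι ι K) :
    commForm F x y = trace ((F * x - x * F) * y) := by
  rw [commForm_apply, Matrix.mul_sub, Matrix.sub_mul, trace_sub, trace_sub,
    ← Matrix.mul_assoc, ← Matrix.mul_assoc, trace_mul_cycle F y x]

theorem commForm_add (F G : Matrix ι ι K) : commForm (F + G) = commForm F + commForm G := by
  ext x y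
  simp only [LinearMap.add_apply, commForm_apply, Matrix.add_mul, trace_add]

theorem commForm_smul (c : K) (F : Matrix ι ι K) : commForm (c • F) = c • commForm F := by
  ext x y
  simp only [LinearMap.smul_apply, commForm_apply, Matrix.smul_mul, trace_smul]

/-- The dimension of the radical of `commForm F` on a pattern space. -/
noncomputable def radDim (R : ι → ι → Prop) (F : Matrix ι ι K) : ℕ :=
  finrank K (LinearMap.ker
    ((commForm F).domRestrict₁₂ (patternSpace K R) (patternSpace K R)))

/-- The index of the matrix Lie algebra attached to the pattern `R`.  The relation `R` need not be
transitive for the definition to make sense. -/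
noncomputable def patternIndex (K : Type*) [Field K] (R : ι → ι → Prop) : ℕ :=
  sInf (Set.range fun F : Matrix ι ι K => radDim R F)

theorem patternIndex_le (R : ι → ι → Prop) (F : Matrix ι ι K) : patternIndex K R ≤ radDim R F :=
  Nat.sInf_le ⟨F, rfl⟩

theorem exists_radDim_eq (R : ι → ι → Prop) : ∃ F : Matrix ι ι K, radDim R F = patternIndex K R :=
  Nat.sInf_mem (Set.range_nonempty _)

/-- Passing from a form to a generic point of a line through it does not increase the radical. -/
theorem exists_radDim_add_smul_le [Infinite K] (R : ι → ι → Prop) (F G : Matrix ι ι K)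
    {p : Polynomial K} (hp : p ≠ 0) :
    ∃ t : K, p.eval t ≠ 0 ∧ radDim R (F + t • G) ≤ radDim R F := by
  obtain ⟨t, ht, h⟩ := exists_finrank_ker_add_smul_le
    ((commForm F).domRestrict₁₂ (patternSpace K R) (patternSpace K R))
    ((commForm G).domRestrict₁₂ (patternSpace K R) (patternSpace K R)) hp
  refine ⟨t, ht, ?_⟩
  rw [radDim, commForm_add, commForm_smul]
  exact h

theorem radDim_eq_of_equiv {R : ι → ι → Prop} {R' : κ → κ → Prop} {F : Matrix ι ι K}
    {F' : Matrix κ κ K} (φ : Matrix ι ι K ≃ₗ[K] Matrix κ κ K)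
    (hφ : ∀ x, φ x ∈ patternSpace K R' ↔ x ∈ patternSpace K R) {c : K} (hc : c ≠ 0)
    (h : ∀ x y, commForm F' (φ x) (φ y) = c * commForm F x y) :
    radDim R F = radDim R' F' := by
  have hmap : (patternSpace K R).map (φ : Matrix ι ι K →ₗ[K] Matrix κ κ K) =
      patternSpace K R' := by
    ext z
    obtain ⟨x, rfl⟩ := φ.surjective z
    rw [hφ]
    rw [show φ x = (φ : Matrix ι ι K →ₗ[K] Matrix κ κ K) x from rfl, Submodule.mem_map_equiv]
    simp
  exact finrank_ker_eq_of_equiv (φ.ofSubmodules _ _ hmap) hc fun x y => h x y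

theorem patternIndex_comap_equiv (σ : ι ≃ κ) (R : κ → κ → Prop) :
    patternIndex K (fun i j => R (σ i) (σ j)) = patternIndex K R := by
  have key : ∀ F : Matrix ι ι K,
      radDim (fun i j => R (σ i) (σ j)) F = radDim R (F.submatrix σ.symm σ.symm) := fun F =>
    radDim_eq_of_equiv (Matrix.reindexLinearEquiv K K σ σ)
      (fun x => ⟨fun h i j hij => by simpa using h (σ i) (σ j) hij,
        fun h i j hij => by
          simpa using h (σ.symm i) (σ.symm j) (by simpa using hij)⟩) one_ne_zero
      (fun x y => by
        rw [commForm_apply, commForm_apply, one_mul]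
        simp only [Matrix.coe_reindexLinearEquiv, Matrix.reindex_apply,
          Matrix.submatrix_mul_equiv]
        rw [show (x * y).submatrix σ.symm σ.symm - (y * x).submatrix σ.symm σ.symm =
          (x * y - y * x).submatrix σ.symm σ.symm from rfl, Matrix.submatrix_mul_equiv]
        simp [trace, ← Equiv.sum_comp σ])
  have hsurj : Function.Surjective fun F : Matrix ι ι K => F.submatrix σ.symm σ.symm := fun G =>
    ⟨G.submatrix σ σ, by ext; simp⟩
  rw [patternIndex, patternIndex, ← hsurj.range_comp fun G => radDim R G]
  congr 2
  ext F
  exact key F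

/-- Transposition is an anti-automorphism, so it preserves the index. -/
theorem patternIndex_flip (R : ι → ι → Prop) :
    patternIndex K (fun i j => R j i) = patternIndex K R := by
  have key : ∀ F : Matrix ι ι K, radDim (fun i j => R j i) F = radDim R Fᵀ := fun F =>
    radDim_eq_of_equiv (Matrix.transposeLinearEquiv ι ι K K)
      (fun x => ⟨fun h i j hij => h j i hij, fun h i j hij => h j i hij⟩)
      (neg_ne_zero.2 one_ne_zero)
      (fun x y => by
        rw [commForm_apply, commForm_apply, ← trace_transpose (F * _)]
        simp only [transpose_mul, transpose_sub]
        change trace (Fᵀ * (xᵀ * yᵀ - yᵀ * xᵀ)) = _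
        rw [trace_mul_comm, neg_one_mul, ← trace_neg, ← Matrix.neg_mul, neg_sub])
  have hsurj : Function.Surjective fun F : Matrix ι ι K => Fᵀ := fun G => ⟨Gᵀ, rfl⟩
  rw [patternIndex, patternIndex, ← hsurj.range_comp fun G => radDim R G]
  congr 2
  ext F
  exact key F

variable [DecidableEq ι]

/-- The units of the pattern algebra act on forms without changing the radical. -/
theorem radDim_conj {R : ι → ι → Prop} (hR : ∀ i j k, R i j → R j k → R i k)
    {u v : Matrix ι ι K} (hu : u ∈ patternSpace K R) (hv : v ∈ patternSpace K R)
    (huv : u * v = 1) (F : Matrix ι ι K) : radDim R (v * F * u) = radDim R F := by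
  have hvu : v * u = 1 := mul_eq_one_comm.1 huv
  have e : ∀ x, v * (u * x * v) * u = x := fun x => by
    rw [Matrix.mul_assoc u, ← Matrix.mul_assoc v, hvu, Matrix.one_mul, Matrix.mul_assoc, hvu,
      Matrix.mul_one]
  have e' : ∀ x, u * (v * x * u) * v = x := fun x => by
    rw [Matrix.mul_assoc v, ← Matrix.mul_assoc u, huv, Matrix.one_mul, Matrix.mul_assoc, huv,
      Matrix.mul_one]
  let φ : Matrix ι ι K ≃ₗ[K] Matrix ι ι K :=
    { toFun := fun x => u * x * v
      invFun := fun x => v * x * u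
      map_add' := fun x y => by rw [Matrix.mul_add, Matrix.add_mul]
      map_smul' := fun c x => by simp
      left_inv := e
      right_inv := e' }
  have hmul : ∀ x y, u * x * v * (u * y * v) = u * (x * y) * v := fun x y => by
    calc u * x * v * (u * y * v) = u * x * (v * u) * y * v := by noncomm_ring
      _ = _ := by rw [hvu]; noncomm_ring
  refine radDim_eq_of_equiv (c := 1) φ (fun x => ⟨fun h => ?_, fun h => ?_⟩) one_ne_zero
    fun x y => ?_
  · rw [← e x]
    exact mul_mem_patternSpace hR (mul_mem_patternSpace hR hv h) hu
  · exact mul_mem_patternSpace hR (mul_mem_patternSpace hR hu h) hv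
  · change commForm F (u * x * v) (u * y * v) = _
    rw [one_mul, commForm_apply, commForm_apply, hmul, hmul, ← Matrix.sub_mul, ← Matrix.mul_sub,
      ← Matrix.mul_assoc, trace_mul_comm]
    congr 1
    noncomm_ring

/-- The orthogonal space of a pattern under the trace form. -/
theorem forall_trace_mul_eq_zero_iff (R : ι → ι → Prop) (G : Matrix ι ι K) :
    (∀ y ∈ patternSpace K R, trace (G * y) = 0) ↔ ∀ i j, R i j → G j i = 0 := by
  constructor
  · intro h i j hij
    have := h (Matrix.single i j 1) fun k l hkl => by
      rw [Matrix.single_apply, if_neg]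
      rintro ⟨rfl, rfl⟩
      exact hkl hij
    simpa [Matrix.trace_mul_single] using this
  · intro h y hy
    simp only [trace, diag_apply, Matrix.mul_apply]
    refine Finset.sum_eq_zero fun j _ => Finset.sum_eq_zero fun i _ => ?_
    by_cases hij : R i j
    · rw [h i j hij, zero_mul]
    · rw [hy i j hij, mul_zero]

theorem exists_eq_trace_mul (φ : Matrix ι ι K →ₗ[K] K) : ∃ G, ∀ x, φ x = trace (G * x) := by
  refine ⟨Matrix.of fun i j => φ (Matrix.single j i 1), fun x => ?_⟩
  conv_lhs => rw [Matrix.matrix_eq_sum_single x]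
  simp only [map_sum, trace, diag_apply, Matrix.mul_apply, Matrix.of_apply]
  rw [Finset.sum_comm]
  refine Finset.sum_congr rfl fun j _ => Finset.sum_congr rfl fun i _ => ?_
  rw [show Matrix.single i j (x i j) = x i j • Matrix.single i j (1 : K) by simp, map_smul,
    smul_eq_mul, mul_comm]

end Pattern

/-! ### Reduction along an abelian ideal -/

section Reduction

open Module Matrix

variable {K : Type*} [Field K] {α β : Type*} [Fintype α] [Fintype β] [DecidableEq α]
  [DecidableEq β]

/-- The combinatorial input of a reduction step.  The index set is `α ⊕ β`; the first block of
one flag is `A = α ∪ E`, the first block of the other one is `A ∪ C` with `C = C₀ ∪ e(α)`.  The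
positions `A × C` form an abelian ideal.  As `E` or `C₀` is empty, `α` has as many elements as the
smaller one of `A` and `C`. -/
structure IsReduction (R : α ⊕ β → α ⊕ β → Prop) (e : α → β) (E C₀ : β → Prop) : Prop where
  refl : ∀ i, R i i
  trans : ∀ i j k, R i j → R j k → R i k
  inj : Function.Injective e
  not_E : ∀ i, ¬E (e i)
  not_C₀ : ∀ i, ¬C₀ (e i)
  /-- One of `E` and `C₀` is empty. -/
  not_both : ∀ b b', E b → ¬C₀ b'
  inl_inl : ∀ i j, R (Sum.inl i) (Sum.inl j)
  inl_inr : ∀ i b, R (Sum.inl i) (Sum.inr b) ↔ E b ∨ C₀ b ∨ ∃ j, b = e j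
  inr_inl : ∀ b i, R (Sum.inr b) (Sum.inl i) ↔ E b
  of_E : ∀ b b', E b → (R (Sum.inr b) (Sum.inr b') ↔ E b' ∨ ∃ j, b' = e j)
  to_E : ∀ b b', E b' → (R (Sum.inr b) (Sum.inr b') ↔ E b)
  of_C₀ : ∀ b b', C₀ b → R (Sum.inr b) (Sum.inr b') → C₀ b' ∨ ∃ j, b' = e j
  of_e : ∀ i b', R (Sum.inr (e i)) (Sum.inr b') → C₀ b' ∨ ∃ j, b' = e j
  C₀_e : ∀ b i, C₀ b → R (Sum.inr b) (Sum.inr (e i))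

/-- The pattern on `β` that remains after the reduction.  The positions `C₀ × e(α)` disappear: the
entries there vanish on the orthogonal space of the ideal. -/
def reducedPattern (R : α ⊕ β → α ⊕ β → Prop) (e : α → β) (C₀ : β → Prop) (b b' : β) : Prop :=
  R (Sum.inr b) (Sum.inr b') ∧ ¬(C₀ b ∧ ∃ j, b' = e j)

/-- The abelian ideal, as a set of positions: `A × C`. -/
def idealPattern (e : α → β) (E C₀ : β → Prop) : α ⊕ β → α ⊕ β → Prop
  | Sum.inl _, Sum.inr b => C₀ b ∨ ∃ j, b = e j
  | Sum.inr b, Sum.inr b' => E b ∧ ∃ j, b' = e j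
  | _, Sum.inl _ => False

/-- A form whose restriction to the ideal `A × C` is the partial identity given by `e`.  As the
form is `x ↦ tr (F x)`, this concerns the entries of `F` in `C × A`; those in `C₀ × E` need no
condition, because one of `E` and `C₀` is empty. -/
structure IsNormalForm (e : α → β) (E C₀ : β → Prop) (F : Matrix (α ⊕ β) (α ⊕ β) K) : Prop where
  e_inl : ∀ i j, F (Sum.inr (e i)) (Sum.inl j) = if i = j then 1 else 0
  C₀_inl : ∀ b j, C₀ b → F (Sum.inr b) (Sum.inl j) = 0
  e_E : ∀ i b, E b → F (Sum.inr (e i)) (Sum.inr b) = 0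

variable {R : α ⊕ β → α ⊕ β → Prop} {e : α → β} {E C₀ : β → Prop}

namespace IsReduction

variable (h : IsReduction R e E C₀)
include h

theorem ideal_le : patternSpace K (idealPattern e E C₀) ≤ patternSpace K R := by
  rintro x hx (i | b) (j | b') hij
  · exact hx _ _ id
  · exact hx _ _ fun h' => hij ((h.inl_inr _ _).2 (Or.inr h'))
  · exact hx _ _ id
  · exact hx _ _ fun h' => hij ((h.of_E _ _ h'.1).2 (Or.inr h'.2))

variable {F : Matrix (α ⊕ β) (α ⊕ β) K} {x : Matrix (α ⊕ β) (α ⊕ β) K}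

/-! The next lemmas compute those entries of `F * x - x * F` which pair with the ideal. -/

theorem mul_e_inl (hF : IsNormalForm e E C₀ F) (hx : x ∈ patternSpace K R) (i j : α) :
    (F * x) (Sum.inr (e i)) (Sum.inl j) = x (Sum.inl i) (Sum.inl j) := by
  rw [Matrix.mul_apply, Fintype.sum_sum_type]
  rw [Finset.sum_eq_zero (s := (Finset.univ : Finset β)) fun b _ => ?_]
  · simp [hF.e_inl]
  · by_cases hb : E b
    · rw [hF.e_E _ _ hb, zero_mul]
    · rw [hx _ _ fun h' => hb ((h.inr_inl _ _).1 h'), mul_zero]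

theorem mul_C₀_inl (hF : IsNormalForm e E C₀ F) (hx : x ∈ patternSpace K R) (b : β) (hb : C₀ b)
    (j : α) : (F * x) (Sum.inr b) (Sum.inl j) = 0 := by
  rw [Matrix.mul_apply, Fintype.sum_sum_type]
  rw [Finset.sum_eq_zero (s := (Finset.univ : Finset β)) fun b' _ => ?_,
    Finset.sum_eq_zero fun i _ => ?_, zero_add]
  · rw [hF.C₀_inl _ _ hb, zero_mul]
  · rw [hx _ _ fun h' => h.not_both _ _ ((h.inr_inl _ _).1 h') hb, mul_zero]

theorem mul_e_E (hF : IsNormalForm e E C₀ F) (hx : x ∈ patternSpace K R) (i : α) (b : β)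
    (hb : E b) : (F * x) (Sum.inr (e i)) (Sum.inr b) = x (Sum.inl i) (Sum.inr b) := by
  rw [Matrix.mul_apply, Fintype.sum_sum_type]
  rw [Finset.sum_eq_zero (s := (Finset.univ : Finset β)) fun b' _ => ?_]
  · simp [hF.e_inl]
  · by_cases hb' : E b'
    · rw [hF.e_E _ _ hb', zero_mul]
    · rw [hx _ _ fun h' => hb' ((h.to_E _ _ hb).1 h'), mul_zero]

theorem apply_mul_inl (hF : IsNormalForm e E C₀ F) (r : α ⊕ β)
    (h1 : ∀ i, x r (Sum.inl i) = 0)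
    (h2 : ∀ b, x r (Sum.inr b) ≠ 0 → C₀ b ∨ ∃ j, b = e j) (j : α) :
    (x * F) r (Sum.inl j) = x r (Sum.inr (e j)) := by
  rw [Matrix.mul_apply, Fintype.sum_sum_type]
  rw [Finset.sum_eq_zero fun i _ => by rw [h1, zero_mul], zero_add,
    Finset.sum_eq_single (e j)]
  · simp [hF.e_inl]
  · intro b _ hb
    by_cases h0 : x r (Sum.inr b) = 0
    · rw [h0, zero_mul]
    · rcases h2 b h0 with h3 | ⟨i, rfl⟩
      · rw [hF.C₀_inl _ _ h3, mul_zero]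
      · rw [hF.e_inl, if_neg fun hij => hb (by rw [hij]), mul_zero]
  · simp

theorem apply_mul_E (hF : IsNormalForm e E C₀ F) (r : α ⊕ β)
    (h1 : ∀ i, x r (Sum.inl i) = 0)
    (h2 : ∀ b, x r (Sum.inr b) ≠ 0 → C₀ b ∨ ∃ j, b = e j) (b : β) (hb : E b) :
    (x * F) r (Sum.inr b) = 0 := by
  rw [Matrix.mul_apply, Fintype.sum_sum_type]
  rw [Finset.sum_eq_zero fun i _ => by rw [h1, zero_mul], zero_add]
  refine Finset.sum_eq_zero fun b' _ => ?_
  by_cases h0 : x r (Sum.inr b') = 0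
  · rw [h0, zero_mul]
  · rcases h2 b' h0 with h3 | ⟨i, rfl⟩
    · exact absurd h3 (h.not_both _ _ hb)
    · rw [hF.e_E _ _ hb, mul_zero]

theorem row_inl (hx : x ∈ patternSpace K R) {c : β} (hc : C₀ c ∨ ∃ j, c = e j) (i : α) :
    x (Sum.inr c) (Sum.inl i) = 0 := by
  refine hx _ _ fun h' => ?_
  rw [h.inr_inl] at h'
  rcases hc with hc | ⟨j, rfl⟩
  · exact h.not_both _ _ h' hc
  · exact h.not_E _ h'

theorem row_inr (hx : x ∈ patternSpace K R) {c : β} (hc : C₀ c ∨ ∃ j, c = e j) (b : β)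
    (hb : x (Sum.inr c) (Sum.inr b) ≠ 0) : C₀ b ∨ ∃ j, b = e j := by
  have hR : R (Sum.inr c) (Sum.inr b) := by
    by_contra h'
    exact hb (hx _ _ h')
  rcases hc with hc | ⟨j, rfl⟩
  · exact h.of_C₀ _ _ hc hR
  · exact h.of_e _ _ hR

/-- The orthogonal space of the ideal with respect to a form in normal form. -/
theorem orthogonal_iff (hF : IsNormalForm e E C₀ F) (hx : x ∈ patternSpace K R) :
    (∀ y ∈ patternSpace K (idealPattern e E C₀), commForm F x y = 0) ↔
      (∀ i j, x (Sum.inl i) (Sum.inl j) = x (Sum.inr (e i)) (Sum.inr (e j))) ∧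
      (∀ b j, C₀ b → x (Sum.inr b) (Sum.inr (e j)) = 0) ∧
      (∀ i b, E b → x (Sum.inl i) (Sum.inr b) = 0) := by
  simp only [commForm_eq]
  rw [forall_trace_mul_eq_zero_iff]
  have r1 := fun i j => h.apply_mul_inl hF (Sum.inr (e i)) (h.row_inl hx (Or.inr ⟨i, rfl⟩))
    (h.row_inr hx (Or.inr ⟨i, rfl⟩)) j
  have r2 := fun b hb j => h.apply_mul_inl hF (Sum.inr b) (h.row_inl hx (Or.inl hb))
    (h.row_inr hx (Or.inl hb)) j
  have r3 := fun i b hb => h.apply_mul_E hF (Sum.inr (e i)) (h.row_inl hx (Or.inr ⟨i, rfl⟩))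
    (h.row_inr hx (Or.inr ⟨i, rfl⟩)) b hb
  constructor
  · intro H
    refine ⟨fun i j => ?_, fun b j hb => ?_, fun i b hb => ?_⟩
    · have := H (Sum.inl j) (Sum.inr (e i)) (Or.inr ⟨i, rfl⟩)
      rw [Matrix.sub_apply, h.mul_e_inl hF hx, r1] at this
      exact sub_eq_zero.1 this
    · have := H (Sum.inl j) (Sum.inr b) (Or.inl hb)
      rw [Matrix.sub_apply, h.mul_C₀_inl hF hx b hb, r2 b hb] at this
      simpa using this
    · have := H (Sum.inr b) (Sum.inr (e i)) ⟨hb, i, rfl⟩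
      rw [Matrix.sub_apply, h.mul_e_E hF hx i b hb, r3 i b hb, sub_zero] at this
      exact this
  · rintro ⟨H1, H2, H3⟩ (j | b) (i | c) hij
    · exact hij.elim
    · rw [Matrix.sub_apply]
      rcases hij with hc | ⟨i, rfl⟩
      · rw [h.mul_C₀_inl hF hx c hc, r2 c hc, H2 c j hc, sub_zero]
      · rw [h.mul_e_inl hF hx, r1, H1, sub_self]
    · exact hij.elim
    · obtain ⟨hb, i, rfl⟩ := hij
      rw [Matrix.sub_apply, h.mul_e_E hF hx i b hb, r3 i b hb, H3 i b hb, sub_zero]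

/-- The ideal is abelian, since a product of two of its elements vanishes. -/
theorem isotropic {y : Matrix (α ⊕ β) (α ⊕ β) K}
    (hx : x ∈ patternSpace K (idealPattern e E C₀))
    (hy : y ∈ patternSpace K (idealPattern e E C₀)) : commForm F x y = 0 := by
  have key : ∀ {x y : Matrix (α ⊕ β) (α ⊕ β) K}, x ∈ patternSpace K (idealPattern e E C₀) →
      y ∈ patternSpace K (idealPattern e E C₀) → x * y = 0 := by
    intro x y hx hy
    ext a c
    rw [Matrix.mul_apply, Fintype.sum_sum_type]
    rw [Finset.sum_eq_zero fun i _ => by rw [hx a (Sum.inl i) (by cases a <;> exact id), zero_mul],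
      zero_add]
    refine Finset.sum_eq_zero fun b _ => ?_
    by_cases hb : E b
    · rw [hx a (Sum.inr b), zero_mul]
      rcases a with i | b'
      · rintro (h' | ⟨j, rfl⟩)
        · exact h.not_both _ _ hb h'
        · exact h.not_E _ hb
      · rintro ⟨_, j, rfl⟩
        exact h.not_E _ hb
    · rw [hy (Sum.inr b) c, mul_zero]
      rcases c with i | b'
      · exact id
      · exact fun h' => hb h'.1
  rw [commForm_apply, key hx hy, key hy hx]
  simp

/-- The ideal meets the radical of a form in normal form trivially. -/
theorem eq_zero_of_mem_radical (hF : IsNormalForm e E C₀ F)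
    (hx : x ∈ patternSpace K (idealPattern e E C₀))
    (hrad : ∀ y ∈ patternSpace K R, commForm F x y = 0) : x = 0 := by
  simp only [commForm_eq] at hrad
  rw [forall_trace_mul_eq_zero_iff] at hrad
  have hcol : ∀ r i, x r (Sum.inl i) = 0 := fun r i => hx _ _ (by cases r <;> exact id)
  have hC : ∀ r b, x r (Sum.inr b) ≠ 0 → C₀ b ∨ ∃ j, b = e j := by
    intro r b hb
    by_contra h'
    refine hb (hx _ _ ?_)
    rcases r with i | b'
    · exact h'
    · exact fun h'' => h' (Or.inr h''.2)
  have h1 : ∀ r j, R (Sum.inl j) r → x r (Sum.inr (e j)) = 0 := by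
    intro r j hr
    have := hrad _ _ hr
    rw [Matrix.sub_apply, h.apply_mul_inl hF r (hcol r) (hC r), Matrix.mul_apply,
      Finset.sum_eq_zero fun k _ => by rw [hcol, mul_zero]] at this
    simpa using this
  ext r (i | b)
  · exact hcol _ _
  · by_contra hb
    rcases hC r b hb with h0 | ⟨j, rfl⟩
    · rcases r with i | b'
      · have := hrad _ _ (h.C₀_e b i h0)
        rw [Matrix.sub_apply, Matrix.mul_apply, Matrix.mul_apply,
          Finset.sum_eq_zero (f := fun k => x _ k * F k _) fun k _ => ?_, sub_zero,
          Fintype.sum_sum_type,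
          Finset.sum_eq_zero (s := (Finset.univ : Finset β)) fun b' _ => ?_] at this
        · simp only [hF.e_inl, ite_mul, one_mul, zero_mul, Finset.sum_ite_eq, Finset.mem_univ,
            if_true, add_zero] at this
          exact hb this
        · by_cases hE : E b'
          · rw [hF.e_E _ _ hE, zero_mul]
          · rw [hx (Sum.inr b') (Sum.inr b) fun h' => hE h'.1, mul_zero]
        · rw [hx (Sum.inr (e i)) k, zero_mul]
          rcases k with k | k
          · exact id
          · exact fun h' => h.not_E _ h'.1
      · refine hb (hx _ _ ?_)
        rintro ⟨_, j, rfl⟩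
        exact h.not_C₀ _ h0
    · rcases r with i | b'
      · exact hb (h1 _ _ (h.inl_inl _ _))
      · by_cases hE : E b'
        · exact hb (h1 _ _ ((h.inl_inr _ _).2 (Or.inl hE)))
        · exact hb (hx _ _ fun h' => hE h'.1)

end IsReduction

open Classical in
/-- The embedding of the reduced algebra into the orthogonal space of the ideal: the columns `e(α)`
of the rows `e(α) ∪ E` of `s` are repeated in the columns `α` of the rows `α ∪ E`. -/
noncomputable def lift (e : α → β) (E : β → Prop) :
    Matrix β β K →ₗ[K] Matrix (α ⊕ β) (α ⊕ β) K where
  toFun s := fromBlocks (s.submatrix e e) 0 (of fun b j => if E b then s b (e j) else 0) s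
  map_add' s t := by
    rw [fromBlocks_add, add_zero]
    congr 1
    ext b j
    by_cases hb : E b <;> simp [hb]
  map_smul' c s := by
    rw [RingHom.id_apply, fromBlocks_smul, smul_zero]
    congr 1
    ext b j
    by_cases hb : E b <;> simp [hb]

theorem lift_inl_inl (s : Matrix β β K) (i j : α) :
    lift e E s (Sum.inl i) (Sum.inl j) = s (e i) (e j) := rfl

theorem lift_inl_inr (s : Matrix β β K) (i : α) (b : β) :
    lift e E s (Sum.inl i) (Sum.inr b) = 0 := rfl

theorem lift_inr_inr (s : Matrix β β K) (b b' : β) :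
    lift e E s (Sum.inr b) (Sum.inr b') = s b b' := rfl

theorem lift_inr_inl_of (s : Matrix β β K) (b : β) (j : α) (hb : E b) :
    lift e E s (Sum.inr b) (Sum.inl j) = s b (e j) := by
  simp [lift, hb]

theorem lift_inr_inl_of_not (s : Matrix β β K) (b : β) (j : α) (hb : ¬E b) :
    lift e E s (Sum.inr b) (Sum.inl j) = 0 := by
  simp [lift, hb]

theorem sum_eq_sum_comp (he : Function.Injective e) (f : β → K)
    (hf : ∀ b, (¬∃ j, b = e j) → f b = 0) : ∑ b, f b = ∑ i, f (e i) :=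
  (Fintype.sum_of_injective e he _ _ (fun b hb => hf b fun ⟨j, hj⟩ => hb ⟨j, hj.symm⟩)
    fun _ => rfl).symm

namespace IsReduction

variable (h : IsReduction R e E C₀)
include h

theorem lift_mem {s : Matrix β β K} (hs : s ∈ patternSpace K (reducedPattern R e C₀)) :
    lift e E s ∈ patternSpace K R := by
  rintro (i | b) (j | b') hij
  · exact absurd (h.inl_inl i j) hij
  · rfl
  · exact lift_inr_inl_of_not _ _ _ fun hb => hij ((h.inr_inl _ _).2 hb)
  · exact hs _ _ fun h' => hij h'.1

theorem lift_mul {s t : Matrix β β K} (hs : s ∈ patternSpace K (reducedPattern R e C₀))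
    (ht : t ∈ patternSpace K (reducedPattern R e C₀)) :
    lift e E s * lift e E t = lift e E (s * t) := by
  ext (i | b) (j | b')
  · rw [Matrix.mul_apply, Fintype.sum_sum_type]
    simp only [lift_inl_inl, lift_inl_inr, zero_mul, Finset.sum_const_zero, add_zero,
      Matrix.mul_apply]
    refine (sum_eq_sum_comp h.inj (fun b => s (e i) b * t b (e j)) fun b hb => ?_).symm
    by_cases hC : C₀ b
    · rw [ht b (e j) fun h' => h'.2 ⟨hC, j, rfl⟩, mul_zero]
    · rw [hs (e i) b, zero_mul]
      intro h'
      rcases h.of_e _ _ h'.1 with h1 | h1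
      · exact hC h1
      · exact hb h1
  · rw [Matrix.mul_apply, Fintype.sum_sum_type]
    simp only [lift_inl_inr, zero_mul, mul_zero, Finset.sum_const_zero, add_zero]
  · rw [Matrix.mul_apply, Fintype.sum_sum_type]
    by_cases hb : E b
    · simp only [lift_inl_inl, lift_inr_inl_of _ _ _ hb, lift_inr_inr, Matrix.mul_apply]
      classical
      have h1 := sum_eq_sum_comp h.inj (fun b' => if ∃ j, b' = e j then s b b' * t b' (e j) else 0)
        fun b' hb' => if_neg hb'
      simp only [show ∀ i, ∃ j, e i = e j from fun i => ⟨i, rfl⟩, if_true] at h1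
      rw [← h1, ← Finset.sum_add_distrib]
      refine Finset.sum_congr rfl fun b' _ => ?_
      by_cases hb' : E b'
      · rw [lift_inr_inl_of _ _ _ hb', if_neg, zero_add]
        rintro ⟨k, rfl⟩
        exact h.not_E _ hb'
      · rw [lift_inr_inl_of_not _ _ _ hb', mul_zero, add_zero]
        split_ifs with hk
        · rfl
        · rw [hs b b', zero_mul]
          intro h'
          rcases (h.of_E _ _ hb).1 h'.1 with h2 | h2
          · exact hb' h2
          · exact hk h2
    · rw [lift_inr_inl_of_not _ _ _ hb,
        Finset.sum_eq_zero fun i _ => by rw [lift_inr_inl_of_not _ _ _ hb, zero_mul], zero_add]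
      refine Finset.sum_eq_zero fun b' _ => ?_
      by_cases hb' : E b'
      · rw [lift_inr_inr, hs b b' fun h' => hb ((h.to_E _ _ hb').1 h'.1), zero_mul]
      · rw [lift_inr_inl_of_not _ _ _ hb', mul_zero]
  · rw [Matrix.mul_apply, Fintype.sum_sum_type]
    simp only [lift_inl_inr, mul_zero, Finset.sum_const_zero, zero_add, lift_inr_inr,
      Matrix.mul_apply]

theorem reduced_trans (i j k : β) (hij : reducedPattern R e C₀ i j)
    (hjk : reducedPattern R e C₀ j k) : reducedPattern R e C₀ i k := by
  refine ⟨h.trans _ _ _ hij.1 hjk.1, ?_⟩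
  rintro ⟨hi, hk⟩
  rcases h.of_C₀ _ _ hi hij.1 with hj | hj
  · exact hjk.2 ⟨hj, hk⟩
  · exact hij.2 ⟨hi, hj⟩

/-- The reduction for a form in normal form: the ideal is the isotropic subspace, and `lift` embeds
the reduced algebra as a complement of it in its orthogonal space. -/
theorem radDim_eq {F : Matrix (α ⊕ β) (α ⊕ β) K} (hF : IsNormalForm e E C₀ F)
    {F' : Matrix β β K}
    (hFF' : ∀ s ∈ patternSpace K (reducedPattern R e C₀),
      trace (F * lift e E s) = trace (F' * s)) :
    radDim R F = radDim (reducedPattern R e C₀) F' := by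
  refine finrank_ker_eq_of_isotropic (fun x y => commForm_antisymm F x y)
    ((patternSpace K (idealPattern e E C₀)).comap (patternSpace K R).subtype)
    (fun x hx y hy => h.isotropic hx hy)
    (fun x hx H => Subtype.ext (h.eq_zero_of_mem_radical hF hx fun y hy => H ⟨y, hy⟩))
    ((lift e E).restrict fun s hs => h.lift_mem hs) (fun s t => ?_) (fun s y hy => ?_)
    (fun s hs => ?_) (fun x hx => ?_)
  · change commForm F (lift e E s.1) (lift e E t.1) = commForm F' s.1 t.1
    rw [commForm_apply, commForm_apply, h.lift_mul s.2 t.2, h.lift_mul t.2 s.2, ← map_sub,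
      hFF' _ (Submodule.sub_mem _ (mul_mem_patternSpace h.reduced_trans s.2 t.2)
        (mul_mem_patternSpace h.reduced_trans t.2 s.2))]
  · refine (h.orthogonal_iff hF (h.lift_mem s.2)).2 ⟨fun i j => rfl, fun b j hb => ?_,
      fun i b hb => rfl⟩ y.1 hy
    exact s.2 b (e j) fun h' => h'.2 ⟨hb, j, rfl⟩
  · have hs' : ∀ a c, ¬idealPattern e E C₀ a c → lift e E s.1 a c = 0 := hs
    ext b b'
    by_cases hbb : E b ∧ ∃ j, b' = e j
    · obtain ⟨hb, j, rfl⟩ := hbb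
      have := hs' (Sum.inr b) (Sum.inl j) id
      rw [lift_inr_inl_of _ _ _ hb] at this
      exact this
    · exact hs' (Sum.inr b) (Sum.inr b') hbb
  · obtain ⟨H1, H2, H3⟩ := (h.orthogonal_iff hF x.2).1 fun y hy =>
      hx ⟨y, h.ideal_le hy⟩ hy
    classical
    -- the entries of `x` in `E × e(α)` belong to the ideal, so those in `E × α` take their place
    let s : Matrix β β K := of fun b b' =>
      if hb : E b ∧ ∃ j, b' = e j then x.1 (Sum.inr b) (Sum.inl hb.2.choose)
      else x.1 (Sum.inr b) (Sum.inr b')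
    have s1 : ∀ b j, E b → s b (e j) = x.1 (Sum.inr b) (Sum.inl j) := by
      intro b j hb
      have hb' : E b ∧ ∃ k, e j = e k := ⟨hb, j, rfl⟩
      simp only [s, of_apply, dif_pos hb']
      rw [h.inj hb'.2.choose_spec.symm]
    have s2 : ∀ b b', ¬(E b ∧ ∃ j, b' = e j) → s b b' = x.1 (Sum.inr b) (Sum.inr b') := by
      intro b b' hb
      simp only [s, of_apply, dif_neg hb]
    have hs : s ∈ patternSpace K (reducedPattern R e C₀) := by
      intro b b' hbb
      by_cases hb : E b ∧ ∃ j, b' = e j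
      · exact absurd ⟨(h.of_E _ _ hb.1).2 (Or.inr hb.2), fun h' => h.not_both _ _ hb.1 h'.1⟩ hbb
      · rw [s2 _ _ hb]
        by_cases hR : R (Sum.inr b) (Sum.inr b')
        · by_contra h0
          refine hbb ⟨hR, ?_⟩
          rintro ⟨hC, j, rfl⟩
          exact h0 (H2 b j hC)
        · exact x.2 _ _ hR
    refine ⟨⟨s, hs⟩, ?_⟩
    have : x.1 - lift e E s ∈ patternSpace K (idealPattern e E C₀) := by
      rintro (i | b) (j | b') hij <;> rw [Matrix.sub_apply]
      · rw [lift_inl_inl, s2 _ _ fun h' => h.not_E _ h'.1, H1, sub_self]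
      · rw [lift_inl_inr, sub_zero]
        by_cases hb : E b'
        · exact H3 i b' hb
        · exact x.2 _ _ fun h' => by
            rcases (h.inl_inr _ _).1 h' with h1 | h1
            · exact hb h1
            · exact hij h1
      · by_cases hb : E b
        · rw [lift_inr_inl_of _ _ _ hb, s1 _ _ hb, sub_self]
        · rw [lift_inr_inl_of_not _ _ _ hb, sub_zero]
          exact x.2 _ _ fun h' => hb ((h.inr_inl _ _).1 h')
      · rw [lift_inr_inr, s2 _ _ hij, sub_self]
    exact this

/-- Every form on the reduced algebra is the restriction of a form in normal form. -/
theorem exists_normalForm (F' : Matrix β β K) :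
    ∃ F : Matrix (α ⊕ β) (α ⊕ β) K, IsNormalForm e E C₀ F ∧
      ∀ s, trace (F * lift e E s) = trace (F' * s) := by
  classical
  -- a normal form vanishes on `e(α) × E`; the entries of `F'` there move to `α × E`, where they pair
  -- with the entries repeated by `lift`
  refine ⟨fromBlocks 0 (of fun i b => F' (e i) b) (of fun b j => if b = e j then 1 else 0)
    (of fun b b' => if E b' ∧ ∃ j, b = e j then 0 else F' b b'), ⟨fun i j => ?_,
      fun b j hb => ?_, fun i b hb => ?_⟩, fun s => ?_⟩
  · simp [h.inj.eq_iff]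
  · rw [fromBlocks_apply₂₁, of_apply, if_neg]
    rintro rfl
    exact h.not_C₀ _ hb
  · simp [hb]
  · have h1 := sum_eq_sum_comp h.inj
      (fun b => ∑ b', if E b' ∧ ∃ j, b = e j then F' b b' * s b' b else 0)
      fun b hb => Finset.sum_eq_zero fun b' _ => if_neg fun h' => hb h'.2
    simp only [trace, diag_apply, Matrix.mul_apply, Fintype.sum_sum_type, fromBlocks_apply₁₁,
      fromBlocks_apply₁₂, fromBlocks_apply₂₁, fromBlocks_apply₂₂, Matrix.zero_apply, zero_mul,
      Finset.sum_const_zero, zero_add, lift_inl_inr, mul_zero, lift_inr_inr, of_apply]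
    rw [show ∑ i, ∑ b, F' (e i) b * lift e E s (Sum.inr b) (Sum.inl i) =
      ∑ i, ∑ b', if E b' ∧ ∃ j, e i = e j then F' (e i) b' * s b' (e i) else 0 from
      Finset.sum_congr rfl fun i _ => Finset.sum_congr rfl fun b _ => ?_, ← h1,
      ← Finset.sum_add_distrib]
    · refine Finset.sum_congr rfl fun b _ => ?_
      rw [← Finset.sum_add_distrib]
      refine Finset.sum_congr rfl fun b' _ => ?_
      split_ifs <;> simp
    · by_cases hb : E b
      · rw [lift_inr_inl_of _ _ _ hb, if_pos ⟨hb, i, rfl⟩]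
      · rw [lift_inr_inl_of_not _ _ _ hb, if_neg fun h' => hb h'.1, mul_zero]

/-- A form whose restriction to `A × C` has an invertible block at `α × e(α)` is conjugate to a
form in normal form. -/
theorem exists_conj_normalForm (F : Matrix (α ⊕ β) (α ⊕ β) K)
    (hdet : (of fun i j => F (Sum.inr (e i)) (Sum.inl j)).det ≠ 0) :
    ∃ G : Matrix (α ⊕ β) (α ⊕ β) K, IsNormalForm e E C₀ G ∧ radDim R G = radDim R F := by
  classical
  set M : Matrix α α K := of fun i j => F (Sum.inr (e i)) (Sum.inl j) with hM
  let N : Matrix α β K := of fun i b => if E b then F (Sum.inr (e i)) (Sum.inr b) else 0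
  have hMu : IsUnit M.det := hdet.isUnit
  -- column operations with the block `A` make the rows `e(α)` of `F` equal to `(1 | 0)`
  let u : Matrix (α ⊕ β) (α ⊕ β) K := fromBlocks M⁻¹ (-(M⁻¹ * N)) 0 1
  let v : Matrix (α ⊕ β) (α ⊕ β) K := fromBlocks M N 0 1
  have hu : u ∈ patternSpace K R := by
    rintro (i | b) (j | b') hij
    · exact absurd (h.inl_inl i j) hij
    · have : ∀ k, N k b' = 0 := fun k =>
        if_neg fun hb => hij ((h.inl_inr _ _).2 (Or.inl hb))
      simp [u, Matrix.mul_apply, this]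
    · rfl
    · simp only [u, fromBlocks_apply₂₂]
      exact Matrix.one_apply_ne fun hb => hij (hb ▸ h.refl _)
  have hv : v ∈ patternSpace K R := by
    rintro (i | b) (j | b') hij
    · exact absurd (h.inl_inl i j) hij
    · exact if_neg fun hb => hij ((h.inl_inr _ _).2 (Or.inl hb))
    · rfl
    · simp only [v, fromBlocks_apply₂₂]
      exact Matrix.one_apply_ne fun hb => hij (hb ▸ h.refl _)
  have huv : u * v = 1 := by
    simp [u, v, fromBlocks_multiply, Matrix.nonsing_inv_mul _ hMu]
  let F₁ := v * F * u
  have hF₁ : radDim R F₁ = radDim R F := radDim_conj h.trans hu hv huv F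
  have e₁ : ∀ b c, F₁ (Sum.inr b) c = (F * u) (Sum.inr b) c := by
    intro b c
    simp only [F₁]
    rw [Matrix.mul_assoc, Matrix.mul_apply, Fintype.sum_sum_type]
    simp [v, Matrix.one_apply]
  have a₁ : ∀ i j, F₁ (Sum.inr (e i)) (Sum.inl j) = if i = j then 1 else 0 := by
    intro i j
    rw [e₁, Matrix.mul_apply, Fintype.sum_sum_type]
    simp only [u, fromBlocks_apply₁₁, fromBlocks_apply₂₁, Matrix.zero_apply, mul_zero,
      Finset.sum_const_zero, add_zero]
    change ∑ k, M i k * M⁻¹ k j = _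
    rw [← Matrix.mul_apply, Matrix.mul_nonsing_inv _ hMu, Matrix.one_apply]
  have a₂ : ∀ i b, E b → F₁ (Sum.inr (e i)) (Sum.inr b) = 0 := by
    intro i b hb
    rw [e₁, Matrix.mul_apply, Fintype.sum_sum_type]
    simp only [u, fromBlocks_apply₁₂, fromBlocks_apply₂₂]
    have h1 : ∑ k, F (Sum.inr (e i)) (Sum.inl k) * (-(M⁻¹ * N)) k b = -(N i b) := by
      change ∑ k, M i k * (-(M⁻¹ * N)) k b = _
      rw [← Matrix.mul_apply, Matrix.mul_neg, ← Matrix.mul_assoc, Matrix.mul_nonsing_inv _ hMu,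
        Matrix.one_mul, Matrix.neg_apply]
    rw [h1]
    simp [Matrix.one_apply, N, hb]
  -- a row operation from `e(α)` to `C₀` then clears the rows `C₀`
  let q : Matrix (α ⊕ β) (α ⊕ β) K := fromBlocks 0 0 0 (of fun b b' =>
    ∑ j, if C₀ b ∧ b' = e j then F₁ (Sum.inr b) (Sum.inl j) else 0)
  have q0 : ∀ b b', ¬(C₀ b ∧ ∃ j, b' = e j) → q (Sum.inr b) (Sum.inr b') = 0 := by
    intro b b' hb
    simp only [q, fromBlocks_apply₂₂, of_apply]
    exact Finset.sum_eq_zero fun j _ => if_neg fun h' => hb ⟨h'.1, j, h'.2⟩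
  have q1 : ∀ b j, C₀ b → q (Sum.inr b) (Sum.inr (e j)) = F₁ (Sum.inr b) (Sum.inl j) := by
    intro b j hb
    simp [q, hb, h.inj.eq_iff]
  have hq : q ∈ patternSpace K R := by
    rintro (i | b) (j | b') hij
    · rfl
    · rfl
    · rfl
    · refine q0 _ _ ?_
      rintro ⟨hb, j, rfl⟩
      exact hij (h.C₀_e _ _ hb)
  have hone : (1 : Matrix (α ⊕ β) (α ⊕ β) K) ∈ patternSpace K R := fun i j hij =>
    Matrix.one_apply_ne fun hb => hij (hb ▸ h.refl _)
  have hqq : q * q = 0 := by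
    ext (i | b) (j | b')
    · simp [Matrix.mul_apply, q]
    · simp [Matrix.mul_apply, q]
    · simp [Matrix.mul_apply, q]
    · rw [Matrix.mul_apply, Fintype.sum_sum_type]
      rw [Finset.sum_eq_zero fun i _ => mul_eq_zero_of_left rfl _, zero_add]
      refine Finset.sum_eq_zero fun k _ => ?_
      by_cases hk : C₀ k
      · rw [q0 b k, zero_mul]
        rintro ⟨_, j, rfl⟩
        exact h.not_C₀ _ hk
      · rw [q0 k b' fun h' => hk h'.1, mul_zero]
  have hq1 : (1 + q) * (1 - q) = 1 := by
    rw [Matrix.add_mul, Matrix.mul_sub, Matrix.mul_sub, hqq]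
    simp
  have hcol : ∀ a c, (∀ b, c ≠ Sum.inr (e b)) →
      ((1 - q) * F₁ * (1 + q)) a c = F₁ a c - (q * F₁) a c := by
    intro a c hc
    have hc' : ∀ r, q r c = 0 := by
      intro r
      rcases r with i | b <;> rcases c with j | b'
      · rfl
      · rfl
      · rfl
      · refine q0 _ _ ?_
        rintro ⟨_, j, rfl⟩
        exact hc j rfl
    rw [Matrix.mul_add, Matrix.mul_one, Matrix.add_apply, Matrix.mul_apply (N := q),
      Finset.sum_eq_zero fun r _ => by rw [hc', mul_zero], add_zero, Matrix.sub_mul,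
      Matrix.one_mul, Matrix.sub_apply]
  have hrow : ∀ i c, (q * F₁) (Sum.inr (e i)) c = 0 := by
    intro i c
    rw [Matrix.mul_apply, Fintype.sum_sum_type, Finset.sum_eq_zero fun k _ => ?_,
      Finset.sum_eq_zero fun k _ => ?_, add_zero]
    · rw [q0 _ _ fun h' => h.not_C₀ _ h'.1, zero_mul]
    · exact mul_eq_zero_of_left rfl _
  refine ⟨(1 - q) * F₁ * (1 + q), ⟨fun i j => ?_, fun b j hb => ?_, fun i b hb => ?_⟩, ?_⟩
  · rw [hcol _ _ (by simp), hrow, a₁, sub_zero]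
  · rw [hcol _ _ (by simp), Matrix.mul_apply, Fintype.sum_sum_type,
      Finset.sum_eq_zero fun k _ => mul_eq_zero_of_left rfl _, zero_add,
      sum_eq_sum_comp h.inj (fun b' => q (Sum.inr b) (Sum.inr b') * F₁ (Sum.inr b') (Sum.inl j))
        fun b' hb' => by rw [q0 _ _ fun h' => hb' h'.2, zero_mul]]
    simp [a₁, q1 _ _ hb]
  · rw [hcol _ _ fun k hk => h.not_E k (by rwa [Sum.inr.inj hk] at hb), hrow, a₂ _ _ hb, sub_zero]
  · rw [radDim_conj h.trans (Submodule.add_mem _ hone hq) (Submodule.sub_mem _ hone hq) hq1, hF₁]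

/-- The reduction step: replacing the pattern by the reduced one does not change the index. -/
theorem patternIndex_eq [Infinite K] :
    patternIndex K R = patternIndex K (reducedPattern R e C₀) := by
  apply le_antisymm
  · obtain ⟨F', hF'⟩ := exists_radDim_eq (K := K) (reducedPattern R e C₀)
    obtain ⟨F, hF, hFF'⟩ := h.exists_normalForm F'
    rw [← hF', ← h.radDim_eq hF fun s _ => hFF' s]
    exact patternIndex_le R F
  · obtain ⟨F, hF⟩ := exists_radDim_eq (K := K) R
    -- adding a multiple of the partial identity makes the block at `α × e(α)` invertible
    let M : Matrix α α K := of fun i j => F (Sum.inr (e i)) (Sum.inl j)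
    let G : Matrix (α ⊕ β) (α ⊕ β) K := fromBlocks 0 0 (of fun b j => if b = e j then 1 else 0) 0
    obtain ⟨t, ht, hle⟩ := exists_radDim_add_smul_le R F G (Matrix.charpoly_monic (-M)).ne_zero
    obtain ⟨F₁, hF₁, hr⟩ := h.exists_conj_normalForm (F + t • G) (by
      rw [Matrix.eval_charpoly] at ht
      convert ht using 2
      ext i j
      simp [G, M, h.inj.eq_iff, Matrix.scalar_apply, Matrix.diagonal_apply, add_comm])
    obtain ⟨F', hF'⟩ := exists_eq_trace_mul ((Matrix.traceLinearMap _ K K ∘ₗ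
      LinearMap.mulLeft K F₁) ∘ₗ lift e E)
    rw [← hF]
    refine le_trans (le_trans (patternIndex_le _ F') ?_) hle
    rw [← hr, h.radDim_eq hF₁ fun s _ => hF' s]

end IsReduction

end Reduction

/-! ### Direct sums of pattern algebras -/

section DirectSum

open Module Matrix

variable {K : Type*} [Field K] {α β : Type*} [Fintype α] [Fintype β]

theorem finrank_ker_prod {V U : Type*} [AddCommGroup V] [Module K V] [AddCommGroup U] [Module K U]
    [FiniteDimensional K V] [FiniteDimensional K U]
    (B : V →ₗ[K] V →ₗ[K] K) (B' : U →ₗ[K] U →ₗ[K] K) (C : (V × U) →ₗ[K] (V × U) →ₗ[K] K)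
    (hC : ∀ x y, C x y = B x.1 y.1 + B' x.2 y.2) :
    finrank K (LinearMap.ker C) = finrank K (LinearMap.ker B) + finrank K (LinearMap.ker B') := by
  have h : LinearMap.ker C = (LinearMap.ker B).prod (LinearMap.ker B') := by
    ext x
    rw [Submodule.mem_prod, LinearMap.mem_ker, LinearMap.mem_ker, LinearMap.mem_ker]
    constructor
    · intro hx
      refine ⟨LinearMap.ext fun y => ?_, LinearMap.ext fun y => ?_⟩
      · simpa [hx] using (hC x (y, 0)).symm
      · simpa [hx] using (hC x (0, y)).symm
    · rintro ⟨h1, h2⟩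
      ext y <;> simp [hC, h1, h2]
  rw [h, ← Module.finrank_prod]
  exact LinearEquiv.finrank_eq
    { toFun := fun x => (⟨x.1.1, x.2.1⟩, ⟨x.1.2, x.2.2⟩)
      invFun := fun y => ⟨(y.1.1, y.2.1), y.1.2, y.2.2⟩
      map_add' := fun _ _ => rfl
      map_smul' := fun _ _ => rfl
      left_inv := fun _ => rfl
      right_inv := fun _ => rfl }

theorem radDim_sum {R : α ⊕ β → α ⊕ β → Prop} (h₁₂ : ∀ i b, ¬R (Sum.inl i) (Sum.inr b))
    (h₂₁ : ∀ b i, ¬R (Sum.inr b) (Sum.inl i)) (F : Matrix (α ⊕ β) (α ⊕ β) K) :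
    radDim R F = radDim (fun i j => R (Sum.inl i) (Sum.inl j)) F.toBlocks₁₁ +
      radDim (fun i j => R (Sum.inr i) (Sum.inr j)) F.toBlocks₂₂ := by
  let φ : patternSpace K R ≃ₗ[K] patternSpace K (fun i j => R (Sum.inl i) (Sum.inl j)) ×
      patternSpace K (fun i j => R (Sum.inr i) (Sum.inr j)) :=
    { toFun := fun x => (⟨x.1.toBlocks₁₁, fun i j h => x.2 _ _ h⟩,
        ⟨x.1.toBlocks₂₂, fun i j h => x.2 _ _ h⟩)
      invFun := fun y => ⟨fromBlocks y.1.1 0 0 y.2.1, by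
        rintro (i | b) (j | b') h
        · exact y.1.2 _ _ h
        · rfl
        · rfl
        · exact y.2.2 _ _ h⟩
      map_add' := fun x y => rfl
      map_smul' := fun c x => rfl
      left_inv := fun x => by
        apply Subtype.ext
        ext (i | b) (j | b')
        · rfl
        · exact (x.2 _ _ (h₁₂ _ _)).symm
        · exact (x.2 _ _ (h₂₁ _ _)).symm
        · rfl
      right_inv := fun y => rfl }
  let C := ((commForm F.toBlocks₁₁).domRestrict₁₂
      (patternSpace K (fun i j => R (Sum.inl i) (Sum.inl j)))
      (patternSpace K (fun i j => R (Sum.inl i) (Sum.inl j)))).compl₁₂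
        (LinearMap.fst K _ (patternSpace K (fun i j => R (Sum.inr i) (Sum.inr j))))
        (LinearMap.fst K _ (patternSpace K (fun i j => R (Sum.inr i) (Sum.inr j)))) +
    ((commForm F.toBlocks₂₂).domRestrict₁₂
      (patternSpace K (fun i j => R (Sum.inr i) (Sum.inr j)))
      (patternSpace K (fun i j => R (Sum.inr i) (Sum.inr j)))).compl₁₂
        (LinearMap.snd K (patternSpace K (fun i j => R (Sum.inl i) (Sum.inl j))) _)
        (LinearMap.snd K (patternSpace K (fun i j => R (Sum.inl i) (Sum.inl j))) _)
  rw [radDim, radDim, radDim, ← finrank_ker_prod _ _ C fun x y => rfl]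
  refine finrank_ker_eq_of_equiv φ one_ne_zero fun x y => ?_
  change commForm F.toBlocks₁₁ x.1.toBlocks₁₁ y.1.toBlocks₁₁ +
    commForm F.toBlocks₂₂ x.1.toBlocks₂₂ y.1.toBlocks₂₂ = 1 * commForm F x.1 y.1
  have hb : ∀ z : patternSpace K R, z.1 = fromBlocks z.1.toBlocks₁₁ 0 0 z.1.toBlocks₂₂ := fun z =>
    (congrArg Subtype.val (φ.symm_apply_apply z)).symm
  rw [one_mul, commForm_apply, commForm_apply, commForm_apply]
  conv_rhs => rw [hb x, hb y, ← fromBlocks_toBlocks F]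
  simp only [sub_eq_add_neg, fromBlocks_multiply, fromBlocks_neg, fromBlocks_add, Matrix.mul_zero,
    Matrix.zero_mul, add_zero, zero_add, neg_zero, trace, diag_apply, Fintype.sum_sum_type,
    fromBlocks_apply₁₁, fromBlocks_apply₂₂]

theorem patternIndex_sum {R : α ⊕ β → α ⊕ β → Prop} (h₁₂ : ∀ i b, ¬R (Sum.inl i) (Sum.inr b))
    (h₂₁ : ∀ b i, ¬R (Sum.inr b) (Sum.inl i)) :
    patternIndex K R = patternIndex K (fun i j => R (Sum.inl i) (Sum.inl j)) +
      patternIndex K (fun i j => R (Sum.inr i) (Sum.inr j)) := by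
  apply le_antisymm
  · obtain ⟨F₁, h₁⟩ := exists_radDim_eq (K := K) fun i j => R (Sum.inl i) (Sum.inl j)
    obtain ⟨F₂, h₂⟩ := exists_radDim_eq (K := K) fun i j => R (Sum.inr i) (Sum.inr j)
    refine (patternIndex_le R (fromBlocks F₁ 0 0 F₂)).trans ?_
    rw [radDim_sum h₁₂ h₂₁, toBlocks_fromBlocks₁₁, toBlocks_fromBlocks₂₂, h₁, h₂]
  · obtain ⟨F, hF⟩ := exists_radDim_eq (K := K) R
    rw [← hF, radDim_sum h₁₂ h₂₁]
    exact add_le_add (patternIndex_le _ _) (patternIndex_le _ _)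

end DirectSum

/-! ### The index of `gl(n)` -/

section GeneralLinear

open Module Matrix

variable {K : Type*} [Field K] {n : ℕ}

/-- The rows are `1, F 1, F² 1, …`, where `1` is the all-ones vector. -/
def krylov {A : Type*} [CommRing A] (F : Matrix (Fin n) (Fin n) A) : Matrix (Fin n) (Fin n) A :=
  of fun i => (F ^ (i : ℕ)) *ᵥ 1

theorem krylov_map {A B : Type*} [CommRing A] [CommRing B] (f : A →+* B)
    (F : Matrix (Fin n) (Fin n) A) : (krylov F).map f = krylov (F.map f) := by
  ext i j
  have : F.map f ^ (i : ℕ) = (F ^ (i : ℕ)).map f := (map_pow f.mapMatrix F i).symm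
  simp [krylov, this, Matrix.mulVec, dotProduct]

theorem krylov_diagonal (d : Fin n → K) : krylov (diagonal d) = (vandermonde d)ᵀ := by
  ext i j
  simp [krylov, Matrix.diagonal_pow, Matrix.mulVec_diagonal, vandermonde_apply]

/-- If the all-ones vector is cyclic for `F`, then the powers `1, F, …, F ^ (n - 1)` are linearly
independent elements of the radical. -/
theorem le_radDim_of_krylov {F : Matrix (Fin n) (Fin n) K} (hF : (krylov F).det ≠ 0) :
    n ≤ radDim (fun _ _ => True) F := by
  have hpow : LinearIndependent K fun i : Fin n => F ^ (i : ℕ) := by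
    refine LinearIndependent.of_comp (Matrix.mulVecBilin K K |>.flip 1) ?_
    exact Matrix.linearIndependent_rows_of_det_ne_zero hF
  have hmem : ∀ i : Fin n, F ^ (i : ℕ) ∈ patternSpace K fun _ _ : Fin n => True :=
    fun i _ _ h => absurd trivial h
  have hker : ∀ i : Fin n, (⟨F ^ (i : ℕ), hmem i⟩ : patternSpace K fun _ _ : Fin n => True) ∈
      LinearMap.ker ((commForm F).domRestrict₁₂ (patternSpace K fun _ _ : Fin n => True)
        (patternSpace K fun _ _ : Fin n => True)) := by
    intro i
    rw [LinearMap.mem_ker]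
    ext y
    change commForm F (F ^ (i : ℕ)) y.1 = 0
    rw [commForm_eq, ← pow_succ', ← pow_succ, sub_self, Matrix.zero_mul, trace_zero]
  have hli : LinearIndependent K fun i : Fin n =>
      (⟨⟨F ^ (i : ℕ), hmem i⟩, hker i⟩ : LinearMap.ker ((commForm F).domRestrict₁₂
        (patternSpace K fun _ _ : Fin n => True) (patternSpace K fun _ _ : Fin n => True))) :=
    LinearIndependent.of_comp ((patternSpace K fun _ _ : Fin n => True).subtype ∘ₗ
      Submodule.subtype _) hpow
  have hcard := hli.fintype_card_le_finrank
  rw [Fintype.card_fin] at hcard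
  exact hcard

/-- The centralizer of a diagonal matrix with distinct entries consists of diagonal matrices. -/
theorem radDim_diagonal_le {d : Fin n → K} (hd : Function.Injective d) :
    radDim (fun _ _ => True) (diagonal d) ≤ n := by
  have hinj : Function.Injective ((Matrix.diagLinearMap (Fin n) K K ∘ₗ
      (patternSpace K fun _ _ : Fin n => True).subtype) ∘ₗ
      (LinearMap.ker ((commForm (diagonal d)).domRestrict₁₂
        (patternSpace K fun _ _ : Fin n => True)
        (patternSpace K fun _ _ : Fin n => True))).subtype) := by
    refine (injective_iff_map_eq_zero _).2 ?_
    rintro ⟨⟨x, hx⟩, hk⟩ h0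
    have h1 : ∀ i, x i i = 0 := fun i => congrFun h0 i
    have h2 := (forall_trace_mul_eq_zero_iff (fun _ _ => True)
      (diagonal d * x - x * diagonal d)).1 fun y hy => by
        rw [← commForm_eq]
        exact LinearMap.congr_fun (LinearMap.mem_ker.1 hk) ⟨y, hy⟩
    apply Subtype.ext
    apply Subtype.ext
    ext i j
    by_cases hij : i = j
    · rw [hij]
      exact h1 j
    · have := h2 j i trivial
      rw [Matrix.sub_apply, Matrix.diagonal_mul, Matrix.mul_diagonal] at this
      have h3 : (d i - d j) * x i j = 0 := by rw [← this]; ring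
      exact (mul_eq_zero.1 h3).resolve_left (sub_ne_zero.2 fun h => hij (hd h))
  simpa [radDim] using LinearMap.finrank_le_finrank_of_injective hinj

/-- The index of `gl(n)` is `n`. -/
theorem patternIndex_true [CharZero K] : patternIndex K (fun _ _ : Fin n => True) = n := by
  have hd : Function.Injective fun i : Fin n => ((i : ℕ) : K) := fun i j h =>
    Fin.ext (Nat.cast_injective h)
  apply le_antisymm
  · exact (patternIndex_le _ _).trans (radDim_diagonal_le hd)
  · obtain ⟨F, hF⟩ := exists_radDim_eq (K := K) fun _ _ : Fin n => True
    -- on the line from `F` to a diagonal matrix, a generic point has a cyclic vector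
    let G := diagonal (fun i : Fin n => ((i : ℕ) : K)) - F
    let p : Polynomial K := (krylov (F.map Polynomial.C +
      (Polynomial.X : Polynomial K) • G.map Polynomial.C)).det
    have hp : ∀ t, p.eval t = (krylov (F + t • G)).det := by
      intro t
      simp only [p]
      rw [← Polynomial.coe_evalRingHom, RingHom.map_det, RingHom.mapMatrix_apply, krylov_map]
      congr 2
      ext i j
      simp only [Matrix.map_apply, Matrix.add_apply, Matrix.smul_apply, smul_eq_mul,
        Polynomial.coe_evalRingHom, Polynomial.eval_add, Polynomial.eval_C, Polynomial.eval_mul, Polynomial.eval_X]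
    have hp0 : p ≠ 0 := by
      intro h0
      have h1 := hp 1
      rw [h0, one_smul, show F + G = diagonal _ from add_sub_cancel _ _, krylov_diagonal,
        det_transpose, Polynomial.eval_zero] at h1
      exact det_vandermonde_ne_zero_iff.2 hd h1.symm
    obtain ⟨t, ht, hle⟩ := exists_radDim_add_smul_le (fun _ _ : Fin n => True) F G hp0
    rw [hp] at ht
    rw [← hF]
    exact (le_radDim_of_krylov ht).trans hle

end GeneralLinear

/-! ### Blocks of a composition -/

section Blocks

/-- The index of the block that contains position `k` when `ℕ` is cut into consecutive blocks of
the lengths given by a list; all positions beyond the last block form one more block. -/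
def blockOf : List ℕ → ℕ → ℕ
  | [], _ => 0
  | c :: l, k => if k < c then 0 else blockOf l (k - c) + 1

/-- The positions `(i, j)` at which the matrices of the seaweed algebra may be nonzero: the spaces
`V_i` force zeros below the blocks of `a`, the spaces `W_j` force zeros above those of `b`. -/
def seaweedRel (a b : List ℕ) (i j : ℕ) : Prop :=
  blockOf a i ≤ blockOf a j ∧ blockOf b j ≤ blockOf b i

/-- The index of the seaweed subalgebra of `gl(n)` attached to two lists.  The lists are allowed to
contain zeros and to have a sum other than `n`. -/
noncomputable def glIndex (K : Type*) [Field K] (n : ℕ) (a b : List ℕ) : ℕ :=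
  patternIndex K fun i j : Fin n => seaweedRel a b i j

theorem blockOf_cons_of_lt {c k : ℕ} (l : List ℕ) (h : k < c) : blockOf (c :: l) k = 0 :=
  if_pos h

theorem blockOf_cons_of_le {c k : ℕ} (l : List ℕ) (h : c ≤ k) :
    blockOf (c :: l) k = blockOf l (k - c) + 1 :=
  if_neg (not_lt.2 h)

/-- Two positions are in different blocks exactly if a partial sum of the list separates them. -/
theorem blockOf_lt_iff (l : List ℕ) (j i : ℕ) :
    blockOf l j < blockOf l i ↔ ∃ r, j < (l.take r).sum ∧ (l.take r).sum ≤ i := by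
  induction l generalizing i j with
  | nil => simp [blockOf]
  | cons c l ih =>
    have hr : (∃ r, j < ((c :: l).take r).sum ∧ ((c :: l).take r).sum ≤ i) ↔
        ∃ r, j < c + (l.take r).sum ∧ c + (l.take r).sum ≤ i := by
      constructor
      · rintro ⟨_ | r, h⟩
        · simp at h
        · exact ⟨r, by simpa using h⟩
      · rintro ⟨r, h⟩
        exact ⟨r + 1, by simpa using h⟩
    rw [hr]
    by_cases hj : j < c
    · rw [blockOf_cons_of_lt l hj]
      constructor
      · intro h
        refine ⟨0, by simpa using hj, ?_⟩
        by_contra hi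
        rw [blockOf_cons_of_lt l (by simpa using hi)] at h
        exact absurd h (lt_irrefl 0)
      · rintro ⟨r, h1, h2⟩
        rw [blockOf_cons_of_le l (by omega)]
        omega
    · rw [blockOf_cons_of_le l (not_lt.1 hj)]
      by_cases hi : i < c
      · rw [blockOf_cons_of_lt l hi]
        constructor
        · intro h
          omega
        · rintro ⟨r, h1, h2⟩
          omega
      · rw [blockOf_cons_of_le l (not_lt.1 hi), Nat.add_lt_add_iff_right, ih]
        refine exists_congr fun r => ?_
        omega

theorem blockOf_mono (l : List ℕ) : Monotone (blockOf l) := by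
  intro i j hij
  by_contra h
  obtain ⟨r, h1, h2⟩ := (blockOf_lt_iff l j i).1 (not_le.1 h)
  omega

end Blocks

/-! ### Seaweed algebras as pattern algebras -/

section Flags

open Module Matrix

variable {K : Type*} [Field K] {n : ℕ}

theorem mem_span_single_iff (p : Fin n → Prop) (v : Fin n → K) :
    v ∈ Submodule.span K {v | ∃ k : Fin n, p k ∧ v = Pi.single k 1} ↔ ∀ k, ¬p k → v k = 0 := by
  constructor
  · intro hv k hk
    induction hv using Submodule.span_induction with
    | mem x hx =>
      obtain ⟨j, hj, rfl⟩ := hx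
      exact Pi.single_eq_of_ne (by rintro rfl; exact hk hj) _
    | zero => rfl
    | add x y _ _ hx hy => simp [hx, hy]
    | smul c x _ hx => simp [hx]
  · intro h
    rw [pi_eq_sum_univ' v]
    refine Submodule.sum_mem _ fun k _ => ?_
    by_cases hk : p k
    · refine Submodule.smul_mem _ _ (Submodule.subset_span ⟨k, hk, ?_⟩)
      ext j
      simp [Pi.single_apply, eq_comm]
    · rw [h k hk, zero_smul]
      exact Submodule.zero_mem _

/-- Preserving a coordinate subspace means having a block of zeros. -/
theorem forall_mulVec_mem_span_iff (p : Fin n → Prop) (A : Matrix (Fin n) (Fin n) K) :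
    (∀ v ∈ Submodule.span K {v | ∃ k : Fin n, p k ∧ v = Pi.single k 1},
      A.mulVec v ∈ Submodule.span K {v | ∃ k : Fin n, p k ∧ v = Pi.single k 1}) ↔
      ∀ i j, p j → ¬p i → A i j = 0 := by
  constructor
  · intro h i j hj hi
    have := (mem_span_single_iff p _).1
      (h (Pi.single j 1) (Submodule.subset_span ⟨j, hj, rfl⟩)) i hi
    simpa using this
  · intro h v hv
    rw [mem_span_single_iff] at hv ⊢
    intro i hi
    rw [Matrix.mulVec, dotProduct]
    refine Finset.sum_eq_zero fun j _ => ?_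
    by_cases hj : p j
    · rw [h i j hj hi, zero_mul]
    · rw [hv j hj, mul_zero]

theorem mem_seaweed_iff (a b : Composition n) (A : LieAlgebra.SpecialLinear.sl (Fin n) K) :
    A ∈ seaweed K a b ↔
      A.val ∈ patternSpace K fun i j : Fin n => seaweedRel a.blocks b.blocks i j := by
  change ((∀ i, ∀ v ∈ upperFlag K a i, A.val.mulVec v ∈ upperFlag K a i) ∧
    (∀ j, ∀ v ∈ lowerFlag K b j, A.val.mulVec v ∈ lowerFlag K b j)) ↔ _
  simp only [upperFlag, lowerFlag, forall_mulVec_mem_span_iff, mem_patternSpace, seaweedRel,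
    not_and_or, not_le, blockOf_lt_iff, Composition.sizeUpTo]
  constructor
  · rintro ⟨h1, h2⟩ i j (⟨r, hj, hi⟩ | ⟨r, hi, hj⟩)
    · exact h1 r i j hj (not_lt.2 hi)
    · exact h2 r i j hj hi
  · intro h
    exact ⟨fun r i j hj hi => h i j (Or.inl ⟨r, hj, not_lt.1 hi⟩),
      fun r i j hj hi => h i j (Or.inr ⟨r, hi, hj⟩)⟩

/-- The scalar matrices split off: the index in `sl(n)` is one less than the index in `gl(n)`. -/
theorem index_seaweed_add_one [CharZero K] (hn : 0 < n) (a b : Composition n) :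
    index K (seaweed K a b) + 1 = glIndex K n a.blocks b.blocks := by
  set R : Fin n → Fin n → Prop := fun i j => seaweedRel a.blocks b.blocks i j with hR
  let inc : seaweed K a b →ₗ[K] Matrix (Fin n) (Fin n) K :=
    { toFun := fun x => x.1.1
      map_add' := fun _ _ => rfl
      map_smul' := fun _ _ => rfl }
  have inc_mem : ∀ x, inc x ∈ patternSpace K R := fun x => (mem_seaweed_iff a b x.1).1 x.2
  have inc_trace : ∀ x, trace (inc x) = 0 := fun x =>
    LinearMap.mem_ker.1 x.1.2
  have inc_surj : ∀ A ∈ patternSpace K R, trace A = 0 → ∃ x, inc x = A := fun A hA hA0 =>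
    ⟨⟨⟨A, LinearMap.mem_ker.2 hA0⟩, (mem_seaweed_iff a b _).2 hA⟩, rfl⟩
  have inc_inj : Function.Injective inc := fun x y h => Subtype.ext (Subtype.ext h)
  have inc_lie : ∀ x y, inc ⁅x, y⁆ = inc x * inc y - inc y * inc x := fun x y => rfl
  have hone : (1 : Matrix (Fin n) (Fin n) K) ∈ patternSpace K R := fun i j hij =>
    Matrix.one_apply_ne fun h => hij (by rw [h]; exact ⟨le_rfl, le_rfl⟩)
  have hn0 : (n : K) ≠ 0 := Nat.cast_ne_zero.2 hn.ne'
  have hc : ∀ (F x : Matrix (Fin n) (Fin n) K), commForm F 1 x = 0 := fun F x => by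
    rw [commForm_apply]; simp
  have hc' : ∀ (F x : Matrix (Fin n) (Fin n) K), commForm F x 1 = 0 := fun F x => by
    rw [commForm_apply]; simp
  have hdec : ∀ A ∈ patternSpace K R, ∃ x, ∃ c : K, A = inc x + c • 1 := by
    intro A hA
    obtain ⟨x, hx⟩ := inc_surj (A - (trace A / n) • 1)
      (Submodule.sub_mem _ hA (Submodule.smul_mem _ _ hone)) (by
        rw [trace_sub, trace_smul, trace_one, Fintype.card_fin, smul_eq_mul,
          div_mul_cancel₀ _ hn0, sub_self])
    exact ⟨x, trace A / n, by rw [hx, sub_add_cancel]⟩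
  have key : ∀ (f : Module.Dual K (seaweed K a b)) (F : Matrix (Fin n) (Fin n) K),
      (∀ x, f x = trace (F * inc x)) →
      finrank K (LinearMap.ker (kirillovForm K f)) + 1 = radDim R F := by
    intro f F hfF
    have hform : ∀ x y, kirillovForm K f x y = commForm F (inc x) (inc y) := fun x y => by
      change f ⁅x, y⁆ = _
      rw [hfF, inc_lie, commForm_apply]
    have hker : ∀ x, x ∈ LinearMap.ker (kirillovForm K f) →
        ∀ y ∈ patternSpace K R, commForm F (inc x) y = 0 := by
      intro x hx y hy
      obtain ⟨z, c, rfl⟩ := hdec y hy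
      rw [map_add, map_smul, hc', smul_zero, add_zero, ← hform, LinearMap.mem_ker.1 hx]
      rfl
    let φ : (LinearMap.ker (kirillovForm K f) × K) →ₗ[K] LinearMap.ker
        ((commForm F).domRestrict₁₂ (patternSpace K R) (patternSpace K R)) :=
      { toFun := fun z => ⟨⟨inc z.1.1 + z.2 • 1,
          Submodule.add_mem _ (inc_mem _) (Submodule.smul_mem _ _ hone)⟩, by
            rw [LinearMap.mem_ker]
            ext y
            change commForm F (inc z.1.1 + z.2 • 1) y.1 = 0
            rw [map_add, map_smul, LinearMap.add_apply, LinearMap.smul_apply, hc, smul_zero,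
              add_zero, hker _ z.1.2 _ y.2]⟩
        map_add' := fun z w => by
          apply Subtype.ext
          apply Subtype.ext
          change inc (z.1.1 + w.1.1) + (z.2 + w.2) • (1 : Matrix (Fin n) (Fin n) K) =
            (inc z.1.1 + z.2 • 1) + (inc w.1.1 + w.2 • 1)
          rw [map_add, add_smul]
          abel
        map_smul' := fun c z => by
          apply Subtype.ext
          apply Subtype.ext
          change inc (c • z.1.1) + (c • z.2) • (1 : Matrix (Fin n) (Fin n) K) =
            c • (inc z.1.1 + z.2 • 1)
          rw [map_smul, smul_add, smul_assoc] }
    have hφ : Function.Bijective φ := by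
      constructor
      · refine (injective_iff_map_eq_zero _).2 ?_
        rintro ⟨x, c⟩ h0
        have h1 : inc x.1 + c • (1 : Matrix (Fin n) (Fin n) K) = 0 :=
          congrArg (fun z => z.1.1) h0
        have h2 := congrArg trace h1
        rw [trace_add, inc_trace, trace_smul, trace_one, Fintype.card_fin, trace_zero, zero_add,
          smul_eq_mul] at h2
        have h3 : c = 0 := (mul_eq_zero.1 h2).resolve_right hn0
        rw [h3, zero_smul, add_zero] at h1
        have h4 : x = 0 := Subtype.ext (inc_inj (by rw [h1]; rfl))
        rw [h3, h4]
        rfl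
      · rintro ⟨⟨A, hA⟩, hAk⟩
        obtain ⟨x, c, rfl⟩ := hdec A hA
        refine ⟨(⟨x, ?_⟩, c), rfl⟩
        rw [LinearMap.mem_ker]
        ext y
        rw [hform]
        have h1 : commForm F (inc x + c • 1) (inc y) = 0 :=
          LinearMap.congr_fun (LinearMap.mem_ker.1 hAk) ⟨inc y, inc_mem y⟩
        rw [map_add, map_smul, LinearMap.add_apply, LinearMap.smul_apply, hc, smul_zero,
          add_zero] at h1
        exact h1
    have := LinearEquiv.finrank_eq (LinearEquiv.ofBijective φ hφ)
    rw [Module.finrank_prod, Module.finrank_self] at this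
    exact this
  obtain ⟨q, hq⟩ := LinearMap.exists_leftInverse_of_injective inc
    (LinearMap.ker_eq_bot.2 inc_inj)
  apply le_antisymm
  · obtain ⟨F, hF⟩ := exists_radDim_eq (K := K) R
    let f : Module.Dual K (seaweed K a b) :=
      (Matrix.traceLinearMap _ K K ∘ₗ LinearMap.mulLeft K F) ∘ₗ inc
    have h1 := key f F fun x => rfl
    have h2 := (index_isLeast K (seaweed K a b)).2 ⟨f, rfl⟩
    change _ ≤ patternIndex K R
    rw [← hF, ← h1]
    exact Nat.add_le_add_right h2 1
  · obtain ⟨f, hf⟩ := (index_isLeast K (seaweed K a b)).1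
    obtain ⟨F, hF⟩ := exists_eq_trace_mul (f ∘ₗ q)
    have h1 := key f F fun x => by
      rw [← hF, LinearMap.comp_apply]
      exact congrArg f (LinearMap.congr_fun hq x).symm
    change patternIndex K R ≤ _
    rw [← hf]
    dsimp only
    rw [h1]
    exact patternIndex_le R F

end Flags

/-! ### The recursion for the index -/

section Recursion

open Module Matrix

variable (K : Type*) [Field K]

theorem glIndex_zero (a b : List ℕ) : glIndex K 0 a b = 0 := by
  refine Nat.le_zero.1 ((patternIndex_le _ 0).trans ?_)
  exact (Submodule.finrank_le _).trans ((Submodule.finrank_le _).trans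
    (by rw [Module.finrank_zero_of_subsingleton]))

theorem glIndex_comm (n : ℕ) (a b : List ℕ) : glIndex K n a b = glIndex K n b a := by
  rw [glIndex, glIndex, ← patternIndex_flip]
  congr 1
  ext i j
  exact and_comm

theorem blockOf_zero_cons (l : List ℕ) (k : ℕ) : blockOf (0 :: l) k = blockOf l k + 1 :=
  blockOf_cons_of_le l (Nat.zero_le k)

theorem glIndex_zero_cons_right (n : ℕ) (a b : List ℕ) :
    glIndex K n a (0 :: b) = glIndex K n a b := by
  simp only [glIndex, seaweedRel, blockOf_zero_cons, Nat.add_le_add_iff_right]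

/-- The pattern on `Fin (m + n)`, with the first `m` positions separated from the others. -/
theorem glIndex_eq_sum (m n : ℕ) (a b : List ℕ) :
    glIndex K (m + n) a b = patternIndex K fun i j : Fin m ⊕ Fin n =>
      seaweedRel a b (finSumFinEquiv i) (finSumFinEquiv j) :=
  (patternIndex_comap_equiv finSumFinEquiv fun i j : Fin (m + n) => seaweedRel a b i j).symm

/-- Equal first parts split off `gl(c)`. -/
theorem glIndex_cons_self [CharZero K] (c n : ℕ) (a b : List ℕ) :
    glIndex K (c + n) (c :: a) (c :: b) = c + glIndex K n a b := by
  rw [glIndex_eq_sum, patternIndex_sum]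
  · congr 1
    · have h : (fun i j : Fin c => seaweedRel (c :: a) (c :: b)
          (finSumFinEquiv (Sum.inl i : Fin c ⊕ Fin n)) (finSumFinEquiv (Sum.inl j : Fin c ⊕ Fin n)))
          = fun _ _ => True := by
        funext i j
        simp [seaweedRel, blockOf]
      rw [h, patternIndex_true]
    · rw [glIndex]
      congr 1
      ext i j
      simp [seaweedRel, blockOf]
  · intro i j
    simp [seaweedRel, blockOf]
  · intro i j
    simp [seaweedRel, blockOf]

theorem blockOf_cases (c : ℕ) (l : List ℕ) (k : ℕ) :
    k < c ∧ blockOf (c :: l) k = 0 ∨ c ≤ k ∧ blockOf (c :: l) k = blockOf l (k - c) + 1 :=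
  (lt_or_ge k c).imp (fun h => ⟨h, blockOf_cons_of_lt l h⟩) fun h => ⟨h, blockOf_cons_of_le l h⟩

theorem exists_eq_shift_iff {m n s : ℕ} (h : s + m ≤ n) (b : Fin n) :
    (∃ j : Fin m, b = (⟨s + j, by omega⟩ : Fin n)) ↔ s ≤ (b : ℕ) ∧ (b : ℕ) < s + m := by
  constructor
  · rintro ⟨j, rfl⟩
    simp
  · rintro ⟨h1, h2⟩
    exact ⟨⟨b - s, by omega⟩, Fin.ext (by simp; omega)⟩

/-- Reduction when the smaller first part is at most half of the larger one.  Of the first `2m + s`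
positions, the first `m` ones are `A`, the next `s` ones are `C₀`, and the last `m` ones are `e(α)`;
`C₀` and `e(α)` become blocks of their own. -/
theorem glIndex_reduce_small [Infinite K] {m n s : ℕ} (h : s + m ≤ n) (a b : List ℕ) :
    glIndex K (m + n) (m :: a) ((2 * m + s) :: b) = glIndex K n a (s :: m :: b) := by
  have hred : IsReduction (fun i j : Fin m ⊕ Fin n => seaweedRel (m :: a) ((2 * m + s) :: b)
      (finSumFinEquiv i) (finSumFinEquiv j)) (fun i => (⟨s + i, by omega⟩ : Fin n))
      (fun _ => False) (fun b => (b : ℕ) < s) :=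
    { refl := fun i => ⟨le_rfl, le_rfl⟩
      trans := fun i j k h1 h2 => ⟨h1.1.trans h2.1, h2.2.trans h1.2⟩
      inj := fun i j hij => by simpa [Fin.ext_iff] using hij
      not_E := fun i => id
      not_C₀ := fun i => by simp
      not_both := fun b b' => False.elim
      inl_inl := fun i j => by
        have h1 := blockOf_cases m a (i)
        have h2 := blockOf_cases (2 * m + s) b (i)
        have h3 := blockOf_cases m a (j)
        have h4 := blockOf_cases (2 * m + s) b (j)
        simp only [seaweedRel, finSumFinEquiv_apply_left, finSumFinEquiv_apply_right,
          Fin.val_castAdd, Fin.val_natAdd, false_or, iff_false]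
        omega
      inl_inr := fun i k => by
        rw [exists_eq_shift_iff h]
        have h1 := blockOf_cases m a (i)
        have h2 := blockOf_cases (2 * m + s) b (i)
        have h3 := blockOf_cases m a (m + k)
        have h4 := blockOf_cases (2 * m + s) b (m + k)
        simp only [seaweedRel, finSumFinEquiv_apply_left, finSumFinEquiv_apply_right,
          Fin.val_castAdd, Fin.val_natAdd, false_or, iff_false]
        omega
      inr_inl := fun k i => by
        have h1 := blockOf_cases m a (m + k)
        have h2 := blockOf_cases (2 * m + s) b (m + k)
        have h3 := blockOf_cases m a (i)
        have h4 := blockOf_cases (2 * m + s) b (i)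
        simp only [seaweedRel, finSumFinEquiv_apply_left, finSumFinEquiv_apply_right,
          Fin.val_castAdd, Fin.val_natAdd, false_or, iff_false]
        omega
      of_E := fun k k' => False.elim
      to_E := fun k k' => False.elim
      of_C₀ := fun k k' => by
        rw [exists_eq_shift_iff h]
        have h1 := blockOf_cases m a (m + k)
        have h2 := blockOf_cases (2 * m + s) b (m + k)
        have h3 := blockOf_cases m a (m + k')
        have h4 := blockOf_cases (2 * m + s) b (m + k')
        simp only [seaweedRel, finSumFinEquiv_apply_left, finSumFinEquiv_apply_right,
          Fin.val_castAdd, Fin.val_natAdd, false_or, iff_false]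
        omega
      of_e := fun i k' => by
        rw [exists_eq_shift_iff h]
        have h1 := blockOf_cases m a (m + (s + i))
        have h2 := blockOf_cases (2 * m + s) b (m + (s + i))
        have h3 := blockOf_cases m a (m + k')
        have h4 := blockOf_cases (2 * m + s) b (m + k')
        simp only [seaweedRel, finSumFinEquiv_apply_left, finSumFinEquiv_apply_right,
          Fin.val_castAdd, Fin.val_natAdd, false_or, iff_false]
        omega
      C₀_e := fun b i hb => by
        simp only [finSumFinEquiv_apply_right]
        refine ⟨blockOf_mono _ (by simp only [Fin.val_natAdd]; omega), ?_⟩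
        rw [blockOf_cons_of_lt _ (by simp only [Fin.val_natAdd]; omega)]
        exact Nat.zero_le _ }
  rw [glIndex_eq_sum, hred.patternIndex_eq, glIndex]
  congr 1
  ext i j
  rw [reducedPattern, exists_eq_shift_iff h]
  have key : ∀ k : ℕ, blockOf (m :: a) (m + k) = blockOf a k + 1 ∧
      (k < s ∧ blockOf ((2 * m + s) :: b) (m + k) = 0 ∧ blockOf (s :: m :: b) k = 0 ∨
        s ≤ k ∧ k < s + m ∧ blockOf ((2 * m + s) :: b) (m + k) = 0 ∧
          blockOf (s :: m :: b) k = 1 ∨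
        s + m ≤ k ∧ blockOf ((2 * m + s) :: b) (m + k) + 1 = blockOf (s :: m :: b) k ∧
          1 < blockOf (s :: m :: b) k) := by
    intro k
    have h1 := blockOf_cases m a (m + k)
    have h2 := blockOf_cases (2 * m + s) b (m + k)
    have h3 := blockOf_cases s (m :: b) k
    have h4 := blockOf_cases m b (k - s)
    rw [Nat.add_sub_cancel_left] at h1
    rw [show m + k - (2 * m + s) = k - s - m by omega] at h2
    omega
  have h1 := key i
  have h2 := key j
  simp only [seaweedRel, finSumFinEquiv_apply_right, Fin.val_natAdd]
  omega

/-- Reduction when the smaller first part is more than half of the larger one.  Of the first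
`2m + s` positions, the first `m` ones are `α`, the next `s` ones are `E`, and the last `m` ones are
`C = e(α)`. -/
theorem glIndex_reduce_large [Infinite K] {m n s : ℕ} (h : s + m ≤ n) (a b : List ℕ) :
    glIndex K (m + n) ((m + s) :: a) ((2 * m + s) :: b) =
      glIndex K n (s :: a) ((m + s) :: b) := by
  have hred : IsReduction (fun i j : Fin m ⊕ Fin n => seaweedRel ((m + s) :: a)
      ((2 * m + s) :: b) (finSumFinEquiv i) (finSumFinEquiv j))
      (fun i => (⟨s + i, by omega⟩ : Fin n)) (fun b => (b : ℕ) < s) (fun _ => False) :=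
    { refl := fun i => ⟨le_rfl, le_rfl⟩
      trans := fun i j k h1 h2 => ⟨h1.1.trans h2.1, h2.2.trans h1.2⟩
      inj := fun i j hij => by simpa [Fin.ext_iff] using hij
      not_E := fun i => by simp
      not_C₀ := fun i => id
      not_both := fun b b' _ => id
      inl_inl := fun i j => by
        have h1 := blockOf_cases (m + s) a (i)
        have h2 := blockOf_cases (2 * m + s) b (i)
        have h3 := blockOf_cases (m + s) a (j)
        have h4 := blockOf_cases (2 * m + s) b (j)
        simp only [seaweedRel, finSumFinEquiv_apply_left, finSumFinEquiv_apply_right,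
          Fin.val_castAdd, Fin.val_natAdd, false_or, iff_false]
        omega
      inl_inr := fun i k => by
        rw [exists_eq_shift_iff h]
        have h1 := blockOf_cases (m + s) a (i)
        have h2 := blockOf_cases (2 * m + s) b (i)
        have h3 := blockOf_cases (m + s) a (m + k)
        have h4 := blockOf_cases (2 * m + s) b (m + k)
        simp only [seaweedRel, finSumFinEquiv_apply_left, finSumFinEquiv_apply_right,
          Fin.val_castAdd, Fin.val_natAdd, false_or, iff_false]
        omega
      inr_inl := fun k i => by
        have h1 := blockOf_cases (m + s) a (m + k)
        have h2 := blockOf_cases (2 * m + s) b (m + k)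
        have h3 := blockOf_cases (m + s) a (i)
        have h4 := blockOf_cases (2 * m + s) b (i)
        simp only [seaweedRel, finSumFinEquiv_apply_left, finSumFinEquiv_apply_right,
          Fin.val_castAdd, Fin.val_natAdd, false_or, iff_false]
        omega
      of_E := fun k k' hb => by
        rw [exists_eq_shift_iff h]
        have h1 := blockOf_cases (m + s) a (m + k)
        have h2 := blockOf_cases (2 * m + s) b (m + k)
        have h3 := blockOf_cases (m + s) a (m + k')
        have h4 := blockOf_cases (2 * m + s) b (m + k')
        simp only [seaweedRel, finSumFinEquiv_apply_left, finSumFinEquiv_apply_right,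
          Fin.val_castAdd, Fin.val_natAdd, false_or, iff_false]
        omega
      to_E := fun k k' hb => by
        have h1 := blockOf_cases (m + s) a (m + k)
        have h2 := blockOf_cases (2 * m + s) b (m + k)
        have h3 := blockOf_cases (m + s) a (m + k')
        have h4 := blockOf_cases (2 * m + s) b (m + k')
        simp only [seaweedRel, finSumFinEquiv_apply_left, finSumFinEquiv_apply_right,
          Fin.val_castAdd, Fin.val_natAdd, false_or, iff_false]
        omega
      of_C₀ := fun k k' => False.elim
      of_e := fun i k' => by
        rw [exists_eq_shift_iff h]
        have h1 := blockOf_cases (m + s) a (m + (s + i))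
        have h2 := blockOf_cases (2 * m + s) b (m + (s + i))
        have h3 := blockOf_cases (m + s) a (m + k')
        have h4 := blockOf_cases (2 * m + s) b (m + k')
        simp only [seaweedRel, finSumFinEquiv_apply_left, finSumFinEquiv_apply_right,
          Fin.val_castAdd, Fin.val_natAdd, false_or, iff_false]
        omega
      C₀_e := fun b i => False.elim }
  rw [glIndex_eq_sum, hred.patternIndex_eq, glIndex]
  congr 1
  ext i j
  have key : ∀ k : ℕ, blockOf ((m + s) :: a) (m + k) = blockOf (s :: a) k ∧
      blockOf ((2 * m + s) :: b) (m + k) = blockOf ((m + s) :: b) k := by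
    intro k
    have h1 := blockOf_cases (m + s) a (m + k)
    have h2 := blockOf_cases (2 * m + s) b (m + k)
    have h3 := blockOf_cases s a k
    have h4 := blockOf_cases (m + s) b k
    rw [show m + k - (m + s) = k - s by omega] at h1
    rw [show m + k - (2 * m + s) = k - (m + s) by omega] at h2
    omega
  simp only [reducedPattern, false_and, not_false_eq_true, and_true, seaweedRel,
    finSumFinEquiv_apply_right, Fin.val_natAdd, (key _).1, (key _).2]

end Recursion

/-! ### Pairs of compositions and the defect -/

section Defect

/-- Two lists of positive integers with the same sum, i.e. two compositions of one integer. -/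
structure Balanced (a b : List ℕ) : Prop where
  left_pos : ∀ i ∈ a, 0 < i
  right_pos : ∀ i ∈ b, 0 < i
  sum_eq : a.sum = b.sum

theorem Balanced.symm {a b : List ℕ} (h : Balanced a b) : Balanced b a :=
  ⟨h.right_pos, h.left_pos, h.sum_eq.symm⟩

theorem balanced_self {a : List ℕ} (h : ∀ i ∈ a, 0 < i) : Balanced a a := ⟨h, h, rfl⟩

theorem balanced_cons_self {c : ℕ} {a b : List ℕ} :
    Balanced (c :: a) (c :: b) ↔ 0 < c ∧ Balanced a b := by
  constructor
  · rintro ⟨h1, h2, h3⟩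
    rw [List.forall_mem_cons] at h1 h2
    rw [List.sum_cons, List.sum_cons] at h3
    exact ⟨h1.1, h1.2, h2.2, by omega⟩
  · rintro ⟨hc, h1, h2, h3⟩
    refine ⟨List.forall_mem_cons.2 ⟨hc, h1⟩, List.forall_mem_cons.2 ⟨hc, h2⟩, ?_⟩
    rw [List.sum_cons, List.sum_cons, h3]

theorem balanced_half {m : ℕ} {a b : List ℕ} (hm : 0 < m) :
    Balanced (m :: a) (2 * m :: b) ↔ Balanced a (m :: b) := by
  constructor
  · rintro ⟨h1, h2, h3⟩
    rw [List.forall_mem_cons] at h1 h2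
    rw [List.sum_cons, List.sum_cons] at h3
    refine ⟨h1.2, List.forall_mem_cons.2 ⟨hm, h2.2⟩, ?_⟩
    rw [List.sum_cons]
    omega
  · rintro ⟨h1, h2, h3⟩
    rw [List.forall_mem_cons] at h2
    rw [List.sum_cons] at h3
    refine ⟨List.forall_mem_cons.2 ⟨hm, h1⟩, List.forall_mem_cons.2 ⟨by omega, h2.2⟩, ?_⟩
    rw [List.sum_cons, List.sum_cons]
    omega

theorem balanced_small {m s : ℕ} {a b : List ℕ} (hm : 0 < m) (hs : 0 < s) :
    Balanced (m :: a) ((2 * m + s) :: b) ↔ Balanced a (s :: m :: b) := by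
  constructor
  · rintro ⟨h1, h2, h3⟩
    rw [List.forall_mem_cons] at h1 h2
    rw [List.sum_cons, List.sum_cons] at h3
    refine ⟨h1.2, List.forall_mem_cons.2 ⟨hs, List.forall_mem_cons.2 ⟨hm, h2.2⟩⟩, ?_⟩
    rw [List.sum_cons, List.sum_cons]
    omega
  · rintro ⟨h1, h2, h3⟩
    rw [List.forall_mem_cons, List.forall_mem_cons] at h2
    rw [List.sum_cons, List.sum_cons] at h3
    refine ⟨List.forall_mem_cons.2 ⟨hm, h1⟩, List.forall_mem_cons.2 ⟨by omega, h2.2.2⟩, ?_⟩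
    rw [List.sum_cons, List.sum_cons]
    omega

theorem balanced_large {m s : ℕ} {a b : List ℕ} (hm : 0 < m) (hs : 0 < s) :
    Balanced ((m + s) :: a) ((2 * m + s) :: b) ↔ Balanced (s :: a) ((m + s) :: b) := by
  constructor
  · rintro ⟨h1, h2, h3⟩
    rw [List.forall_mem_cons] at h1 h2
    rw [List.sum_cons, List.sum_cons] at h3
    refine ⟨List.forall_mem_cons.2 ⟨hs, h1.2⟩, List.forall_mem_cons.2 ⟨by omega, h2.2⟩, ?_⟩
    rw [List.sum_cons, List.sum_cons]
    omega
  · rintro ⟨h1, h2, h3⟩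
    rw [List.forall_mem_cons] at h1 h2
    rw [List.sum_cons, List.sum_cons] at h3
    refine ⟨List.forall_mem_cons.2 ⟨by omega, h1.2⟩, List.forall_mem_cons.2 ⟨by omega, h2.2⟩, ?_⟩
    rw [List.sum_cons, List.sum_cons]
    omega

/-- The shapes of a pair of first parts `x < y`, sorted by the reduction that applies. -/
theorem lt_cases {x y : ℕ} (hxy : x < y) :
    y = 2 * x ∨ (∃ s, 0 < s ∧ y = 2 * x + s) ∨
      ∃ m s, 0 < m ∧ 0 < s ∧ x = m + s ∧ y = 2 * m + s := by
  rcases lt_trichotomy y (2 * x) with h | h | h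
  · exact Or.inr (Or.inr ⟨y - x, 2 * x - y, by omega, by omega, by omega, by omega⟩)
  · exact Or.inl h
  · exact Or.inr (Or.inl ⟨y - 2 * x, by omega, by omega⟩)

/-- Induction along the reduction: a property of pairs of compositions holds if it is symmetric and
passes from the reduced pair to the original one. -/
theorem Balanced.induction {P : List ℕ → List ℕ → Prop} (nil : P [] [])
    (symm : ∀ a b, Balanced a b → P a b → P b a)
    (self : ∀ c a b, 0 < c → Balanced a b → P a b → P (c :: a) (c :: b))
    (half : ∀ m a b, 0 < m → Balanced a (m :: b) → P a (m :: b) → P (m :: a) (2 * m :: b))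
    (small : ∀ m s a b, 0 < m → 0 < s → Balanced a (s :: m :: b) → P a (s :: m :: b) →
      P (m :: a) ((2 * m + s) :: b))
    (large : ∀ m s a b, 0 < m → 0 < s → Balanced (s :: a) ((m + s) :: b) →
      P (s :: a) ((m + s) :: b) → P ((m + s) :: a) ((2 * m + s) :: b))
    {a b : List ℕ} (h : Balanced a b) : P a b := by
  induction hn : a.sum using Nat.strong_induction_on generalizing a b with
  | _ n ih =>
    -- by symmetry, only the case of a smaller first part on the left needs an argument
    have lt : ∀ x a y b, Balanced (x :: a) (y :: b) → (x :: a).sum = n → x < y →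
        P (x :: a) (y :: b) := by
      intro x a y b h hn hxy
      have hx : 0 < x := h.left_pos x (List.mem_cons_self ..)
      rcases lt_cases hxy with rfl | ⟨s, hs, rfl⟩ | ⟨m, s, hm, hs, rfl, rfl⟩
      · have h' := (balanced_half hx).1 h
        exact half x a b hx h' (ih _ (by rw [← hn, List.sum_cons]; omega) h' rfl)
      · have h' := (balanced_small hx hs).1 h
        exact small x s a b hx hs h' (ih _ (by rw [← hn, List.sum_cons]; omega) h' rfl)
      · have h' := (balanced_large hm hs).1 h
        exact large m s a b hm hs h'
          (ih _ (by rw [← hn, List.sum_cons, List.sum_cons]; omega) h' rfl)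
    rcases a with _ | ⟨x, a⟩ <;> rcases b with _ | ⟨y, b⟩
    · exact nil
    · have h1 := h.right_pos y (List.mem_cons_self ..)
      have h2 := h.sum_eq
      rw [List.sum_nil, List.sum_cons] at h2
      omega
    · have h1 := h.left_pos x (List.mem_cons_self ..)
      have h2 := h.sum_eq
      rw [List.sum_nil, List.sum_cons] at h2
      omega
    · rcases lt_trichotomy x y with hxy | rfl | hxy
      · exact lt x a y b h hn hxy
      · obtain ⟨hx, h'⟩ := balanced_cons_self.1 h
        exact self x a b hx h' (ih _ (by rw [← hn, List.sum_cons]; omega) h' rfl)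
      · exact symm _ _ h.symm (lt y b x a h.symm (h.sum_eq ▸ hn) hxy)

variable (K : Type*) [Field K] [CharZero K]

theorem glIndex_half {m n : ℕ} (h : m ≤ n) (a b : List ℕ) :
    glIndex K (m + n) (m :: a) (2 * m :: b) = glIndex K n a (m :: b) := by
  have := glIndex_reduce_small K (s := 0) (by omega : 0 + m ≤ n) a b
  rwa [add_zero, glIndex_zero_cons_right] at this

theorem glIndex_le {a b : List ℕ} (h : Balanced a b) : glIndex K a.sum a b ≤ a.sum := by
  refine h.induction (P := fun a b => glIndex K a.sum a b ≤ a.sum) ?_ ?_ ?_ ?_ ?_ ?_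
  · exact (glIndex_zero K _ _).le
  · intro a b h ih
    rwa [glIndex_comm, ← h.sum_eq]
  · intro c a b _ _ ih
    rw [List.sum_cons, glIndex_cons_self]
    omega
  · intro m a b _ h ih
    have := h.sum_eq
    rw [List.sum_cons] at this ⊢
    rw [glIndex_half K (by omega)]
    omega
  · intro m s a b _ _ h ih
    have := h.sum_eq
    rw [List.sum_cons, List.sum_cons] at this
    rw [List.sum_cons, glIndex_reduce_small K (by omega)]
    omega
  · intro m s a b _ _ h ih
    have := h.sum_eq
    rw [List.sum_cons, List.sum_cons] at this
    rw [List.sum_cons] at ih ⊢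
    rw [show m + s + a.sum = m + (s + a.sum) by ring, glIndex_reduce_large K (by omega)]
    omega


/-- The defect `n - ind` of a seaweed subalgebra of `gl(n)`, where `n` is the sum of the first list.
The subtraction does not truncate for compositions of one integer, by `glIndex_le`. -/
noncomputable def defect (a b : List ℕ) : ℕ := a.sum - glIndex K a.sum a b

theorem defect_nil : defect K [] [] = 0 := by simp [defect]

variable {K} {a b : List ℕ}

theorem defect_comm (h : Balanced a b) : defect K a b = defect K b a := by
  rw [defect, defect, glIndex_comm, h.sum_eq]

theorem defect_cons_self (c : ℕ) : defect K (c :: a) (c :: b) = defect K a b := by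
  rw [defect, defect, List.sum_cons, glIndex_cons_self]
  omega

theorem defect_half {m : ℕ} (h : Balanced a (m :: b)) :
    defect K (m :: a) (2 * m :: b) = m + defect K a (m :: b) := by
  have h1 := glIndex_le K h
  have := h.sum_eq
  rw [List.sum_cons] at this
  rw [defect, defect, List.sum_cons, glIndex_half K (by omega)]
  omega

theorem defect_small {m s : ℕ} (h : Balanced a (s :: m :: b)) :
    defect K (m :: a) ((2 * m + s) :: b) = m + defect K a (s :: m :: b) := by
  have h1 := glIndex_le K h
  have := h.sum_eq
  rw [List.sum_cons, List.sum_cons] at this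
  rw [defect, defect, List.sum_cons, glIndex_reduce_small K (by omega)]
  omega

theorem defect_large {m s : ℕ} (h : Balanced (s :: a) ((m + s) :: b)) :
    defect K ((m + s) :: a) ((2 * m + s) :: b) = m + defect K (s :: a) ((m + s) :: b) := by
  have h1 := glIndex_le K h
  have := h.sum_eq
  rw [List.sum_cons, List.sum_cons] at this
  rw [List.sum_cons] at h1
  rw [defect, defect, List.sum_cons, List.sum_cons,
    show m + s + a.sum = m + (s + a.sum) by ring, glIndex_reduce_large K (by omega)]
  omega

theorem defect_eq_zero_iff (h : Balanced a b) : defect K a b = 0 ↔ a = b := by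
  refine h.induction (P := fun a b => defect K a b = 0 ↔ a = b) ?_ ?_ ?_ ?_ ?_ ?_
  · simp [defect_nil]
  · intro a b h ih
    rw [← defect_comm h, ih, eq_comm]
  · intro c a b _ _ ih
    rw [defect_cons_self, ih]; simp
  · intro m a b hm h ih
    rw [defect_half h]
    refine ⟨fun h => by omega, fun h => ?_⟩
    have := (List.cons.inj h).1
    omega
  · intro m s a b hm hs h ih
    rw [defect_small h]
    refine ⟨fun h => by omega, fun h => ?_⟩
    have := (List.cons.inj h).1
    omega
  · intro m s a b hm hs h ih
    rw [defect_large h]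
    refine ⟨fun h => by omega, fun h => ?_⟩
    have := (List.cons.inj h).1
    omega

end Defect

/-! ### Generating functions of families of pairs -/

section GeneratingFunction

/-- The generating function of a set of pairs of lists, by the sum of the first list.  It counts
with `Set.ncard`, which is meaningful for pairs of compositions by `finite_of_balanced`. -/
noncomputable def gf (T : Set (List ℕ × List ℕ)) : ℚ⟦X⟧ :=
  PowerSeries.mk fun n => ((T ∩ {p | p.1.sum = n}).ncard : ℚ)

theorem finite_of_balanced {T : Set (List ℕ × List ℕ)} (hT : ∀ p ∈ T, Balanced p.1 p.2) (n : ℕ) :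
    (T ∩ {p | p.1.sum = n}).Finite := by
  refine (Set.finite_range fun p : Composition n × Composition n =>
    (p.1.blocks, p.2.blocks)).subset ?_
  rintro ⟨a, b⟩ ⟨hp, hn⟩
  have h := hT _ hp
  exact ⟨(⟨a, fun {i} hi => h.left_pos i hi, hn⟩,
    ⟨b, fun {i} hi => h.right_pos i hi, h.sum_eq.symm.trans hn⟩), rfl⟩

theorem gf_union {T U : Set (List ℕ × List ℕ)} (hT : ∀ p ∈ T, Balanced p.1 p.2)
    (hU : ∀ p ∈ U, Balanced p.1 p.2) (h : ∀ p ∈ T, p ∉ U) : gf (T ∪ U) = gf T + gf U := by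
  ext n
  rw [map_add, gf, gf, gf, PowerSeries.coeff_mk, PowerSeries.coeff_mk, PowerSeries.coeff_mk,
    Set.union_inter_distrib_right, Set.ncard_union_eq _ (finite_of_balanced hT n)
      (finite_of_balanced hU n), Nat.cast_add]
  rw [Set.disjoint_left]
  exact fun p hp hp' => h p hp.1 hp'.1

theorem coeff_X_pow_mul_gf (T : Set (List ℕ × List ℕ)) (m n : ℕ) :
    PowerSeries.coeff n (PowerSeries.X ^ m * gf T) =
      ((T ∩ {p | p.1.sum + m = n}).ncard : ℚ) := by
  rw [PowerSeries.coeff_X_pow_mul', gf, PowerSeries.coeff_mk]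
  split_ifs with h
  · congr 3
    ext p
    rw [Set.mem_ofPred_eq, Set.mem_ofPred_eq]
    omega
  · rw [show T ∩ {p | p.1.sum + m = n} = ∅ from Set.eq_empty_of_forall_notMem fun p hp => by
      have : p.1.sum + m = n := hp.2
      omega]
    simp

theorem gf_image {T : Set (List ℕ × List ℕ)} {φ : List ℕ × List ℕ → List ℕ × List ℕ}
    (hφ : Set.InjOn φ T) (m : ℕ) (hm : ∀ p ∈ T, (φ p).1.sum = p.1.sum + m) :
    gf (φ '' T) = PowerSeries.X ^ m * gf T := by
  ext n
  rw [coeff_X_pow_mul_gf, gf, PowerSeries.coeff_mk,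
    ← Set.InjOn.ncard_image (hφ.mono Set.inter_subset_left)]
  congr 2
  ext q
  constructor
  · rintro ⟨⟨p, hp, rfl⟩, hn⟩
    exact ⟨p, ⟨hp, (hm p hp).symm.trans hn⟩, rfl⟩
  · rintro ⟨p, ⟨hp, hn⟩, rfl⟩
    exact ⟨⟨p, hp, rfl⟩, (hm p hp).trans hn⟩

/-- A family with one free parameter `c = 0, 1, 2, …` that adds `c` to the size contributes a
factor `1 / (1 - X)`. -/
theorem gf_family {T : Set (List ℕ × List ℕ)}
    {φ : ℕ → List ℕ × List ℕ → List ℕ × List ℕ}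
    (hφ : ∀ c, ∀ p ∈ T, ∀ c', ∀ p' ∈ T, φ c p = φ c' p' → c = c' ∧ p = p')
    (m : ℕ) (hm : ∀ c, ∀ p ∈ T, (φ c p).1.sum = p.1.sum + (m + c))
    (hbal : ∀ c, ∀ p ∈ T, Balanced (φ c p).1 (φ c p).2) :
    gf {q | ∃ c, ∃ p ∈ T, q = φ c p} * (1 - PowerSeries.X) = PowerSeries.X ^ m * gf T := by
  set U := {q | ∃ c, ∃ p ∈ T, q = φ c p} with hU
  set V := {q | ∃ c, ∃ p ∈ T, q = φ (c + 1) p} with hV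
  have hUV : U = φ 0 '' T ∪ V := by
    ext q
    constructor
    · rintro ⟨_ | c, p, hp, rfl⟩
      · exact Or.inl ⟨p, hp, rfl⟩
      · exact Or.inr ⟨c, p, hp, rfl⟩
    · rintro (⟨p, hp, rfl⟩ | ⟨c, p, hp, rfl⟩)
      · exact ⟨0, p, hp, rfl⟩
      · exact ⟨c + 1, p, hp, rfl⟩
  have h1 : gf U = PowerSeries.X ^ m * gf T + gf V := by
    rw [hUV, gf_union, gf_image (fun p hp p' hp' h => (hφ 0 p hp 0 p' hp' h).2) m
      fun p hp => hm 0 p hp]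
    · rintro _ ⟨p, hp, rfl⟩
      exact hbal 0 p hp
    · rintro _ ⟨c, p, hp, rfl⟩
      exact hbal _ p hp
    · rintro _ ⟨p, hp, rfl⟩ ⟨c, p', hp', h⟩
      exact absurd (hφ _ p hp _ p' hp' h).1 (Nat.succ_ne_zero c).symm
  have h2 : gf V = PowerSeries.X ^ 1 * gf U := by
    ext n
    rw [coeff_X_pow_mul_gf, gf, PowerSeries.coeff_mk]
    let S : Set (ℕ × (List ℕ × List ℕ)) := {z | z.2 ∈ T ∧ z.2.1.sum + (m + z.1) + 1 = n}
    have e1 : V ∩ {p | p.1.sum = n} = (fun z => φ (z.1 + 1) z.2) '' S := by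
      ext q
      constructor
      · rintro ⟨⟨c, p, hp, rfl⟩, hn⟩
        exact ⟨(c, p), ⟨hp, by rw [← hn, hm _ p hp]; ring⟩, rfl⟩
      · rintro ⟨⟨c, p⟩, ⟨hp, hn⟩, rfl⟩
        exact ⟨⟨c, p, hp, rfl⟩, by rw [Set.mem_ofPred_eq, ← hn, hm _ p hp]; ring⟩
    have e2 : U ∩ {p | p.1.sum + 1 = n} = (fun z => φ z.1 z.2) '' S := by
      ext q
      constructor
      · rintro ⟨⟨c, p, hp, rfl⟩, hn⟩
        exact ⟨(c, p), ⟨hp, by rw [← hn, hm _ p hp]⟩, rfl⟩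
      · rintro ⟨⟨c, p⟩, ⟨hp, hn⟩, rfl⟩
        exact ⟨⟨c, p, hp, rfl⟩, by rw [Set.mem_ofPred_eq, ← hn, hm _ p hp]⟩
    rw [e1, e2, Set.InjOn.ncard_image, Set.InjOn.ncard_image]
    · rintro ⟨c, p⟩ hz ⟨c', p'⟩ hz' h
      obtain ⟨h1, h2⟩ := hφ _ p hz.1 _ p' hz'.1 h
      exact Prod.ext h1 h2
    · rintro ⟨c, p⟩ hz ⟨c', p'⟩ hz' h
      obtain ⟨h1, h2⟩ := hφ _ p hz.1 _ p' hz'.1 h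
      exact Prod.ext (Nat.succ.inj h1) h2
  rw [h2] at h1
  linear_combination h1

/-- Both lists get the same new first part. -/
def prefixFamily (T : Set (List ℕ × List ℕ)) : Set (List ℕ × List ℕ) :=
  {q | ∃ c, ∃ p ∈ T, q = ((c + 1) :: p.1, (c + 1) :: p.2)}

/-- The pairs `m|m|a / 2m|b`. -/
def halfFamily (m : ℕ) (T : Set (List ℕ × List ℕ)) : Set (List ℕ × List ℕ) :=
  (fun p => (m :: m :: p.1, 2 * m :: p.2)) '' T

/-- The pairs `m|c|m|a / 2m+c|b` with `c ≥ 1`. -/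
def smallFamily (m : ℕ) (T : Set (List ℕ × List ℕ)) : Set (List ℕ × List ℕ) :=
  {q | ∃ c, ∃ p ∈ T, q = (m :: (c + 1) :: m :: p.1, (2 * m + (c + 1)) :: p.2)}

variable {T : Set (List ℕ × List ℕ)} {m : ℕ}

theorem prefixFamily_balanced (hT : ∀ p ∈ T, Balanced p.1 p.2) :
    ∀ p ∈ prefixFamily T, Balanced p.1 p.2 := by
  rintro _ ⟨c, p, hp, rfl⟩
  exact balanced_cons_self.2 ⟨Nat.succ_pos c, hT p hp⟩

theorem halfFamily_balanced (hm : 0 < m) (hT : ∀ p ∈ T, Balanced p.1 p.2) :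
    ∀ p ∈ halfFamily m T, Balanced p.1 p.2 := by
  rintro _ ⟨p, hp, rfl⟩
  exact (balanced_half hm).2 (balanced_cons_self.2 ⟨hm, hT p hp⟩)

theorem smallFamily_balanced (hm : 0 < m) (hT : ∀ p ∈ T, Balanced p.1 p.2) :
    ∀ p ∈ smallFamily m T, Balanced p.1 p.2 := by
  rintro _ ⟨c, p, hp, rfl⟩
  exact (balanced_small hm (Nat.succ_pos c)).2
    (balanced_cons_self.2 ⟨Nat.succ_pos c, balanced_cons_self.2 ⟨hm, hT p hp⟩⟩)

theorem gf_prefixFamily (hT : ∀ p ∈ T, Balanced p.1 p.2) :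
    gf (prefixFamily T) * (1 - PowerSeries.X) = PowerSeries.X * gf T := by
  rw [prefixFamily, gf_family (m := 1), pow_one]
  · rintro c ⟨a, b⟩ - c' ⟨a', b'⟩ - h
    simp only [Prod.mk.injEq, List.cons.injEq, Nat.add_right_cancel_iff] at h
    exact ⟨h.1.1, Prod.ext h.1.2 h.2.2⟩
  · intro c p _
    rw [List.sum_cons]
    ring
  · exact fun c p hp => prefixFamily_balanced hT _ ⟨c, p, hp, rfl⟩

theorem gf_halfFamily (m : ℕ) (T : Set (List ℕ × List ℕ)) :
    gf (halfFamily m T) = PowerSeries.X ^ (2 * m) * gf T := by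
  rw [halfFamily, gf_image]
  · rintro ⟨a, b⟩ - ⟨a', b'⟩ - h
    simpa using h
  · intro p _
    rw [List.sum_cons, List.sum_cons]
    ring

theorem gf_smallFamily (hm : 0 < m) (hT : ∀ p ∈ T, Balanced p.1 p.2) :
    gf (smallFamily m T) * (1 - PowerSeries.X) = PowerSeries.X ^ (2 * m + 1) * gf T := by
  rw [smallFamily, gf_family (m := 2 * m + 1)]
  · rintro c ⟨a, b⟩ - c' ⟨a', b'⟩ - h
    simp only [Prod.mk.injEq, List.cons.injEq, true_and] at h
    refine ⟨by omega, ?_⟩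
    rw [h.1.2, h.2.2]
  · intro c p _
    rw [List.sum_cons, List.sum_cons, List.sum_cons]
    ring
  · exact fun c p hp => smallFamily_balanced hm hT _ ⟨c, p, hp, rfl⟩

theorem gf_swap (hT : ∀ p ∈ T, Balanced p.1 p.2) : gf (Prod.swap '' T) = gf T := by
  rw [gf_image (m := 0) Prod.swap_injective.injOn, pow_zero, one_mul]
  exact fun p hp => (hT p hp).sum_eq.symm

theorem swap_balanced (hT : ∀ p ∈ T, Balanced p.1 p.2) :
    ∀ p ∈ Prod.swap '' T, Balanced p.1 p.2 := by
  rintro _ ⟨p, hp, rfl⟩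
  exact (hT p hp).symm

end GeneratingFunction

/-! ### Pairs of defect at most one -/

section Levels

variable (K : Type*) [Field K] [CharZero K]

/-- The pairs of compositions of defect `k`. -/
def level (k : ℕ) : Set (List ℕ × List ℕ) := {p | Balanced p.1 p.2 ∧ defect K p.1 p.2 = k}

/-- The pairs of compositions of defect `k` whose first parts satisfy `a₁ < b₁`. -/
def lower (k : ℕ) : Set (List ℕ × List ℕ) := {p | p ∈ level K k ∧ p.1.headI < p.2.headI}

variable {K} {k c m s : ℕ} {a b : List ℕ}

theorem level_balanced (k : ℕ) : ∀ p ∈ level K k, Balanced p.1 p.2 := fun _ hp => hp.1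

theorem lower_balanced (k : ℕ) : ∀ p ∈ lower K k, Balanced p.1 p.2 := fun _ hp => hp.1.1

theorem mem_level_swap : (b, a) ∈ level K k ↔ (a, b) ∈ level K k :=
  ⟨fun h => ⟨h.1.symm, (defect_comm h.1.symm).trans h.2⟩,
    fun h => ⟨h.1.symm, (defect_comm h.1.symm).trans h.2⟩⟩

theorem mem_level_zero : (a, b) ∈ level K 0 ↔ (∀ i ∈ a, 0 < i) ∧ a = b := by
  constructor
  · rintro ⟨h1, h2⟩
    exact ⟨h1.left_pos, (defect_eq_zero_iff h1).1 h2⟩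
  · rintro ⟨h, rfl⟩
    exact ⟨balanced_self h, (defect_eq_zero_iff (balanced_self h)).2 rfl⟩

theorem mem_level_cons_self : (c :: a, c :: b) ∈ level K k ↔ 0 < c ∧ (a, b) ∈ level K k := by
  change Balanced _ _ ∧ defect K (c :: a) (c :: b) = k ↔ 0 < c ∧ Balanced a b ∧ defect K a b = k
  rw [balanced_cons_self, defect_cons_self, and_assoc]

theorem mem_level_half (hm : 0 < m) :
    (m :: a, 2 * m :: b) ∈ level K k ↔ ∃ k', m + k' = k ∧ (a, m :: b) ∈ level K k' := by
  constructor
  · rintro ⟨h1, h2⟩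
    have h := (balanced_half hm).1 h1
    exact ⟨_, (defect_half h).symm.trans h2, h, rfl⟩
  · rintro ⟨k', rfl, h, rfl⟩
    exact ⟨(balanced_half hm).2 h, defect_half h⟩

theorem mem_level_small (hm : 0 < m) (hs : 0 < s) :
    (m :: a, (2 * m + s) :: b) ∈ level K k ↔
      ∃ k', m + k' = k ∧ (a, s :: m :: b) ∈ level K k' := by
  constructor
  · rintro ⟨h1, h2⟩
    have h := (balanced_small hm hs).1 h1
    exact ⟨_, (defect_small h).symm.trans h2, h, rfl⟩
  · rintro ⟨k', rfl, h, rfl⟩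
    exact ⟨(balanced_small hm hs).2 h, defect_small h⟩

theorem mem_level_large (hm : 0 < m) (hs : 0 < s) :
    ((m + s) :: a, (2 * m + s) :: b) ∈ level K k ↔
      ∃ k', m + k' = k ∧ (s :: a, (m + s) :: b) ∈ level K k' := by
  constructor
  · rintro ⟨h1, h2⟩
    have h := (balanced_large hm hs).1 h1
    exact ⟨_, (defect_large h).symm.trans h2, h, rfl⟩
  · rintro ⟨k', rfl, h, rfl⟩
    exact ⟨(balanced_large hm hs).2 h, defect_large h⟩

/-- A pair with `a₁ < b₁` arises from a pair of smaller defect in one of three ways. -/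
theorem mem_lower_iff {p : List ℕ × List ℕ} :
    p ∈ lower K k ↔ ∃ m k' a b, 0 < m ∧ m + k' = k ∧
      (p = (m :: a, 2 * m :: b) ∧ (a, m :: b) ∈ level K k' ∨
      (∃ s, 0 < s ∧ p = (m :: a, (2 * m + s) :: b) ∧ (a, s :: m :: b) ∈ level K k') ∨
      ∃ s, 0 < s ∧ p = ((m + s) :: a, (2 * m + s) :: b) ∧
        (s :: a, (m + s) :: b) ∈ level K k') := by
  constructor
  · obtain ⟨a, b⟩ := p
    rintro ⟨h, hlt⟩
    rcases b with _ | ⟨y, b⟩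
    · exact absurd hlt (Nat.not_lt_zero _)
    rcases a with _ | ⟨x, a⟩
    · have h1 := h.1.sum_eq
      have h2 : 0 < y := hlt
      simp only [List.sum_nil, List.sum_cons] at h1
      omega
    have hx : 0 < x := h.1.left_pos x (List.mem_cons_self ..)
    rcases lt_cases (show x < y from hlt) with rfl | ⟨s, hs, rfl⟩ | ⟨m, s, hm, hs, rfl, rfl⟩
    · obtain ⟨k', hk, h'⟩ := (mem_level_half hx).1 h
      exact ⟨x, k', a, b, hx, hk, Or.inl ⟨rfl, h'⟩⟩
    · obtain ⟨k', hk, h'⟩ := (mem_level_small hx hs).1 h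
      exact ⟨x, k', a, b, hx, hk, Or.inr (Or.inl ⟨s, hs, rfl, h'⟩)⟩
    · obtain ⟨k', hk, h'⟩ := (mem_level_large hm hs).1 h
      exact ⟨m, k', a, b, hm, hk, Or.inr (Or.inr ⟨s, hs, rfl, h'⟩)⟩
  · rintro ⟨m, k', a, b, hm, hk, ⟨rfl, h⟩ | ⟨s, hs, rfl, h⟩ | ⟨s, hs, rfl, h⟩⟩
    · exact ⟨(mem_level_half hm).2 ⟨k', hk, h⟩, show m < 2 * m by omega⟩
    · exact ⟨(mem_level_small hm hs).2 ⟨k', hk, h⟩, show m < 2 * m + s by omega⟩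
    · exact ⟨(mem_level_large hm hs).2 ⟨k', hk, h⟩, show m + s < 2 * m + s by omega⟩

/-- The first parts of a pair of positive defect are equal, or the pair or its mirror image lies in
`lower K k`.  The empty pair is excluded by its defect. -/
theorem level_eq (hk : k ≠ 0) :
    level K k = prefixFamily (level K k) ∪ (lower K k ∪ Prod.swap '' lower K k) := by
  ext ⟨a, b⟩
  constructor
  · intro h
    rcases lt_trichotomy a.headI b.headI with hlt | heq | hlt
    · exact Or.inr (Or.inl ⟨h, hlt⟩)
    · rcases a with _ | ⟨x, a⟩ <;> rcases b with _ | ⟨y, b⟩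
      · exact absurd (h.2.symm.trans (defect_nil K)) hk
      · exact absurd (h.1.right_pos y (List.mem_cons_self ..)) (by
          rw [← show 0 = y from heq]
          exact lt_irrefl 0)
      · exact absurd (h.1.left_pos x (List.mem_cons_self ..)) (by
          rw [show x = 0 from heq]
          exact lt_irrefl 0)
      · obtain rfl : x = y := heq
        obtain ⟨hx, h'⟩ := mem_level_cons_self.1 h
        exact Or.inl ⟨x - 1, (a, b), h', by rw [Nat.sub_add_cancel hx]⟩
    · exact Or.inr (Or.inr ⟨(b, a), ⟨mem_level_swap.1 h, hlt⟩, rfl⟩)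
  · rintro (⟨c, ⟨a, b⟩, h, hab⟩ | h | ⟨⟨a, b⟩, h, hab⟩)
    · rw [hab]
      exact mem_level_cons_self.2 ⟨Nat.succ_pos c, h⟩
    · exact h.1
    · rw [← hab]
      exact mem_level_swap.1 h.1

theorem gf_level (hk : k ≠ 0) :
    gf (level K k) * (1 - 2 * PowerSeries.X) = 2 * gf (lower K k) * (1 - PowerSeries.X) := by
  have h1 : gf (level K k) = gf (prefixFamily (level K k)) + (gf (lower K k) + gf (lower K k)) := by
    conv_lhs => rw [level_eq hk]
    rw [gf_union (prefixFamily_balanced (level_balanced k)) ?_ ?_,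
      gf_union (lower_balanced k) (swap_balanced (lower_balanced k)) ?_,
      gf_swap (lower_balanced k)]
    · rintro p hp ⟨q, hq, rfl⟩
      exact lt_asymm hp.2 hq.2
    · rintro p (hp | hp)
      · exact lower_balanced k p hp
      · exact swap_balanced (lower_balanced k) p hp
    · rintro _ ⟨c, p, -, rfl⟩ (hp | ⟨q, hq, h⟩)
      · exact lt_irrefl _ hp.2
      · have h3 := hq.2
        rw [← Prod.swap_swap q, h] at h3
        exact lt_irrefl _ h3
  have h2 := gf_prefixFamily (level_balanced (K := K) k)
  linear_combination (1 - PowerSeries.X) * h1 + h2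

theorem gf_level_zero :
    gf (level K 0) * (1 - 2 * PowerSeries.X) = 1 - PowerSeries.X := by
  have h0 : level K 0 = {([], [])} ∪ prefixFamily (level K 0) := by
    ext ⟨a, b⟩
    constructor
    · intro h
      obtain ⟨h1, rfl⟩ := mem_level_zero.1 h
      rcases a with _ | ⟨x, a⟩
      · exact Or.inl rfl
      · obtain ⟨hx, h'⟩ := mem_level_cons_self.1 h
        exact Or.inr ⟨x - 1, (a, a), h', by rw [Nat.sub_add_cancel hx]⟩
    · rintro (h | ⟨c, ⟨a, b⟩, h, hab⟩)
      · obtain ⟨rfl, rfl⟩ := Prod.mk.inj h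
        exact mem_level_zero.2 ⟨by simp, rfl⟩
      · rw [hab]
        exact mem_level_cons_self.2 ⟨Nat.succ_pos c, h⟩
  have hnil : gf {(([] : List ℕ), ([] : List ℕ))} = 1 := by
    ext n
    rw [gf, PowerSeries.coeff_mk, PowerSeries.coeff_one]
    split_ifs with hn
    · subst hn
      rw [Set.inter_eq_left.2 (by simp), Set.ncard_singleton, Nat.cast_one]
    · rw [Set.singleton_inter_eq_empty.2 (by simpa using Ne.symm hn), Set.ncard_empty,
        Nat.cast_zero]
  have h1 : gf (level K 0) = 1 + gf (prefixFamily (level K 0)) := by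
    conv_lhs => rw [h0]
    rw [gf_union ?_ (prefixFamily_balanced (level_balanced 0)) ?_, hnil]
    · rintro p rfl
      exact balanced_self (by simp)
    · rintro p rfl ⟨c, q, -, h⟩
      exact List.cons_ne_nil _ _ (Prod.mk.inj h).1.symm
  have h2 := gf_prefixFamily (level_balanced (K := K) 0)
  linear_combination (1 - PowerSeries.X) * h1 + h2

theorem halfFamily_disjoint_smallFamily (m : ℕ) (T U : Set (List ℕ × List ℕ)) :
    ∀ p ∈ halfFamily m T, p ∉ smallFamily m U := by
  rintro _ ⟨p, -, rfl⟩ ⟨c, q, -, h⟩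
  have := (List.cons.inj (Prod.mk.inj h).2).1
  omega

theorem gf_half_union_small (hm : 0 < m) {T : Set (List ℕ × List ℕ)}
    (hT : ∀ p ∈ T, Balanced p.1 p.2) :
    gf (halfFamily m T ∪ smallFamily m T) * (1 - PowerSeries.X) =
      PowerSeries.X ^ (2 * m) * gf T := by
  rw [gf_union (halfFamily_balanced hm hT) (smallFamily_balanced hm hT)
    (halfFamily_disjoint_smallFamily m T T), gf_halfFamily]
  have := gf_smallFamily hm hT
  linear_combination this

/-- The pairs of defect one with `a₁ < b₁` are `1|1|a / 2|a` and `1|c|1|a / c+2|a`. -/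
theorem lower_one : lower K 1 = halfFamily 1 (level K 0) ∪ smallFamily 1 (level K 0) := by
  ext p
  rw [mem_lower_iff]
  constructor
  · rintro ⟨m, k', a, b, hm, hk, h⟩
    obtain rfl : m = 1 := by omega
    obtain rfl : k' = 0 := by omega
    rcases h with ⟨rfl, h⟩ | ⟨s, hs, rfl, h⟩ | ⟨s, hs, rfl, h⟩
    · obtain ⟨-, rfl⟩ := mem_level_zero.1 h
      exact Or.inl ⟨(b, b), (mem_level_cons_self.1 h).2, rfl⟩
    · obtain ⟨-, rfl⟩ := mem_level_zero.1 h
      exact Or.inr ⟨s - 1, (b, b), (mem_level_cons_self.1 (mem_level_cons_self.1 h).2).2, by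
        rw [Nat.sub_add_cancel hs]⟩
    · have := (List.cons.inj (mem_level_zero.1 h).2).1
      omega
  · rintro (⟨⟨a, b⟩, h, rfl⟩ | ⟨c, ⟨a, b⟩, h, rfl⟩)
    · exact ⟨1, 0, 1 :: a, b, one_pos, rfl,
        Or.inl ⟨rfl, mem_level_cons_self.2 ⟨one_pos, h⟩⟩⟩
    · exact ⟨1, 0, (c + 1) :: 1 :: a, b, one_pos, rfl, Or.inr (Or.inl ⟨c + 1, Nat.succ_pos c, rfl,
        mem_level_cons_self.2 ⟨Nat.succ_pos c, mem_level_cons_self.2 ⟨one_pos, h⟩⟩⟩)⟩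

theorem gf_lower_one :
    gf (lower K 1) * (1 - PowerSeries.X) = PowerSeries.X ^ 2 * gf (level K 0) := by
  rw [lower_one]
  exact gf_half_union_small one_pos (level_balanced 0)

end Levels

/-! ### Pairs of defect two -/

section LevelTwo

variable (K : Type*) [Field K] [CharZero K]

/-- The pairs of defect one with `b₁ = 1`. -/
def levelOneHead : Set (List ℕ × List ℕ) := {p | p ∈ level K 1 ∧ p.2.headI = 1}

/-- The pairs of defect one with `b₂ = 1`. -/
def levelOneSecond : Set (List ℕ × List ℕ) := {p | p ∈ level K 1 ∧ p.2.tail.headI = 1}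

/-- The pairs of defect one with `b₁ = a₁ + 1`. -/
def levelOneSucc : Set (List ℕ × List ℕ) := {p | p ∈ level K 1 ∧ p.1.headI + 1 = p.2.headI}

/-- `a / 1|b ↦ 1|a / 2|b` -/
def bumpRight (p : List ℕ × List ℕ) : List ℕ × List ℕ :=
  (1 :: p.1, (p.2.headI + 1) :: p.2.tail)

/-- `a / c|1|b ↦ 1|a / c+2|b` -/
def mergeRight (p : List ℕ × List ℕ) : List ℕ × List ℕ :=
  (1 :: p.1, (p.2.headI + p.2.tail.headI + 1) :: p.2.tail.tail)

/-- `c|a / c+1|b ↦ c+1|a / c+2|b` -/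
def bumpBoth (p : List ℕ × List ℕ) : List ℕ × List ℕ :=
  ((p.1.headI + 1) :: p.1.tail, (p.2.headI + 1) :: p.2.tail)

variable {K}

theorem exists_eq_cons_of_headI_eq_one {l : List ℕ} (h : l.headI = 1) : ∃ t, l = 1 :: t := by
  rcases l with _ | ⟨x, t⟩
  · exact absurd h zero_ne_one
  · exact ⟨t, by rw [show x = 1 from h]⟩

theorem exists_eq_cons_of_tail_headI_eq_one {l : List ℕ} (h : l.tail.headI = 1) :
    ∃ c t, l = c :: 1 :: t := by
  obtain ⟨t, ht⟩ := exists_eq_cons_of_headI_eq_one h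
  rcases l with _ | ⟨c, l⟩
  · exact absurd ht (List.cons_ne_nil _ _).symm
  · exact ⟨c, t, by rw [← ht]; rfl⟩

/-- The pairs of defect two with `a₁ < b₁` reduce with `m = 2` to a pair of equal lists, or with
`m = 1` to a pair of defect one, from which `bumpRight`, `mergeRight` or `bumpBoth` recovers them. -/
theorem lower_two : lower K 2 = (halfFamily 2 (level K 0) ∪ smallFamily 2 (level K 0)) ∪
    (bumpRight '' levelOneHead K ∪
      (mergeRight '' levelOneSecond K ∪ bumpBoth '' levelOneSucc K)) := by
  ext p
  rw [mem_lower_iff]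
  constructor
  · rintro ⟨m, k', a, b, hm, hk, h⟩
    obtain ⟨rfl, rfl⟩ | ⟨rfl, rfl⟩ : (m = 1 ∧ k' = 1) ∨ (m = 2 ∧ k' = 0) := by omega
    · right
      rcases h with ⟨rfl, h⟩ | ⟨s, hs, rfl, h⟩ | ⟨s, hs, rfl, h⟩
      · exact Or.inl ⟨_, ⟨h, rfl⟩, rfl⟩
      · refine Or.inr (Or.inl ⟨_, ⟨h, rfl⟩, ?_⟩)
        simp only [mergeRight, List.headI_cons, List.tail_cons, Prod.mk.injEq, List.cons.injEq,
          and_true, true_and]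
        omega
      · refine Or.inr (Or.inr ⟨_, ⟨h, Nat.add_comm s 1⟩, ?_⟩)
        simp only [bumpBoth, List.headI_cons, List.tail_cons, Prod.mk.injEq, List.cons.injEq,
          and_true]
        omega
    · left
      rcases h with ⟨rfl, h⟩ | ⟨s, hs, rfl, h⟩ | ⟨s, hs, rfl, h⟩
      · obtain ⟨-, rfl⟩ := mem_level_zero.1 h
        exact Or.inl ⟨(b, b), (mem_level_cons_self.1 h).2, rfl⟩
      · obtain ⟨-, rfl⟩ := mem_level_zero.1 h
        exact Or.inr ⟨s - 1, (b, b), (mem_level_cons_self.1 (mem_level_cons_self.1 h).2).2, by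
          rw [Nat.sub_add_cancel hs]⟩
      · have := (List.cons.inj (mem_level_zero.1 h).2).1
        omega
  · rintro ((⟨⟨a, b⟩, h, rfl⟩ | ⟨c, ⟨a, b⟩, h, rfl⟩) |
      (⟨⟨a, b⟩, ⟨h, hb⟩, rfl⟩ | ⟨⟨a, b⟩, ⟨h, hb⟩, rfl⟩ | ⟨⟨a, b⟩, ⟨h, hb⟩, rfl⟩))
    · exact ⟨2, 0, 2 :: a, b, two_pos, rfl,
        Or.inl ⟨rfl, mem_level_cons_self.2 ⟨two_pos, h⟩⟩⟩
    · exact ⟨2, 0, (c + 1) :: 2 :: a, b, two_pos, rfl, Or.inr (Or.inl ⟨c + 1, Nat.succ_pos c, rfl,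
        mem_level_cons_self.2 ⟨Nat.succ_pos c, mem_level_cons_self.2 ⟨two_pos, h⟩⟩⟩)⟩
    · obtain ⟨b, rfl⟩ := exists_eq_cons_of_headI_eq_one hb
      exact ⟨1, 1, a, b, one_pos, rfl, Or.inl ⟨rfl, h⟩⟩
    · obtain ⟨c, b, rfl⟩ := exists_eq_cons_of_tail_headI_eq_one hb
      have hc : 0 < c := h.1.right_pos c (List.mem_cons_self ..)
      refine ⟨1, 1, a, b, one_pos, rfl, Or.inr (Or.inl ⟨c, hc, ?_, h⟩)⟩
      simp only [mergeRight, List.headI_cons, List.tail_cons, Prod.mk.injEq, List.cons.injEq,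
        and_true, true_and]
      omega
    · rcases b with _ | ⟨y, b⟩
      · exact absurd hb (Nat.succ_ne_zero _)
      rcases a with _ | ⟨x, a⟩
      · have h1 := h.1.sum_eq
        have h2 : 0 + 1 = y := hb
        simp only [List.sum_nil, List.sum_cons] at h1
        omega
      obtain rfl : 1 + x = y := (Nat.add_comm 1 x).trans hb
      have hx : 0 < x := h.1.left_pos x (List.mem_cons_self ..)
      refine ⟨1, 1, a, b, one_pos, rfl, Or.inr (Or.inr ⟨x, hx, ?_, h⟩)⟩
      simp only [bumpBoth, List.headI_cons, List.tail_cons, Prod.mk.injEq, List.cons.injEq,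
        and_true]
      omega

/-- If `b₁ = 1`, then `a₁ = 1` or `a₁ > b₁`; in every pair of `lower K 1` the smaller first part
is `1`. -/
theorem levelOneHead_eq : levelOneHead K =
    (fun p => (1 :: p.1, 1 :: p.2)) '' level K 1 ∪ Prod.swap '' lower K 1 := by
  ext ⟨a, b⟩
  constructor
  · rintro ⟨h, hb⟩
    obtain ⟨b, rfl⟩ := exists_eq_cons_of_headI_eq_one hb
    rcases a with _ | ⟨x, a⟩
    · have h1 := h.1.sum_eq
      simp only [List.sum_nil, List.sum_cons] at h1
      omega
    have hx : 0 < x := h.1.left_pos x (List.mem_cons_self ..)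
    rcases eq_or_lt_of_le (Nat.succ_le_of_lt hx) with rfl | hx
    · exact Or.inl ⟨(a, b), (mem_level_cons_self.1 h).2, rfl⟩
    · exact Or.inr ⟨(1 :: b, x :: a), ⟨mem_level_swap.1 h, hx⟩, rfl⟩
  · rintro (⟨⟨a', b'⟩, h, hab⟩ | ⟨⟨a', b'⟩, h, hab⟩)
    · rw [← hab]
      exact ⟨mem_level_cons_self.2 ⟨one_pos, h⟩, rfl⟩
    · rw [← hab]
      refine ⟨mem_level_swap.1 h.1, ?_⟩
      rw [lower_one] at h
      rcases h with ⟨p, -, h⟩ | ⟨c, p, -, h⟩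
      · rw [← (Prod.mk.inj h).1]
        rfl
      · change a'.headI = 1
        rw [(Prod.mk.inj h).1]
        rfl

theorem gf_levelOneHead :
    gf (levelOneHead K) = PowerSeries.X * gf (level K 1) + gf (lower K 1) := by
  rw [levelOneHead_eq, gf_union ?_ (swap_balanced (lower_balanced 1)) ?_, gf_image ?_ 1 ?_,
    gf_swap (lower_balanced 1), pow_one]
  · rintro ⟨a, b⟩ - ⟨a', b'⟩ - h
    simpa using h
  · intro p _
    rw [List.sum_cons]
    ring
  · rintro _ ⟨p, hp, rfl⟩
    exact balanced_cons_self.2 ⟨one_pos, hp.1⟩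
  · rintro _ ⟨p, hp, rfl⟩ ⟨q, hq, h⟩
    have h3 := hq.2
    rw [← Prod.swap_swap q, h] at h3
    exact lt_irrefl _ h3

theorem levelOneHead_balanced : ∀ p ∈ levelOneHead K, Balanced p.1 p.2 := fun _ hp => hp.1.1

/-- The pairs of defect one with `b₂ = 1`, sorted by their first parts: `a₁ = b₁`; `a₁ < b₁`, namely
`1|1|1|a / 2|1|a` and `1|c|1|1|a / c+2|1|a`; and `a₁ > b₁`, namely `2|a / 1|1|a` and
`3|a / 1|1|1|a`. -/
theorem levelOneSecond_eq : levelOneSecond K = prefixFamily (levelOneHead K) ∪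
    ((halfFamily 1 ((fun p => (1 :: p.1, 1 :: p.2)) '' level K 0) ∪
        smallFamily 1 ((fun p => (1 :: p.1, 1 :: p.2)) '' level K 0)) ∪
      (Prod.swap '' halfFamily 1 (level K 0) ∪
        (fun p => (3 :: p.1, 1 :: 1 :: 1 :: p.2)) '' level K 0)) := by
  ext p
  have key := Set.ext_iff.1 (level_eq (K := K) one_ne_zero) p
  rw [lower_one] at key
  constructor
  · rintro ⟨h, hb⟩
    rcases key.1 h with ⟨c, q, hq, rfl⟩ | (⟨⟨a, b⟩, hq, rfl⟩ | ⟨c, ⟨a, b⟩, hq, rfl⟩) |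
      ⟨_, ⟨⟨a, b⟩, hq, rfl⟩ | ⟨c, ⟨a, b⟩, hq, rfl⟩, rfl⟩
    · exact Or.inl ⟨c, q, ⟨hq, hb⟩, rfl⟩
    · obtain ⟨-, rfl⟩ := mem_level_zero.1 hq
      obtain ⟨b, rfl⟩ := exists_eq_cons_of_headI_eq_one (l := a) hb
      exact Or.inr (Or.inl (Or.inl ⟨_, ⟨(b, b), (mem_level_cons_self.1 hq).2, rfl⟩, rfl⟩))
    · obtain ⟨-, rfl⟩ := mem_level_zero.1 hq
      obtain ⟨b, rfl⟩ := exists_eq_cons_of_headI_eq_one (l := a) hb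
      exact Or.inr (Or.inl (Or.inr ⟨c, _, ⟨(b, b), (mem_level_cons_self.1 hq).2, rfl⟩, rfl⟩))
    · exact Or.inr (Or.inr (Or.inl ⟨_, ⟨(a, b), hq, rfl⟩, rfl⟩))
    · obtain rfl : c = 0 := Nat.succ.inj hb
      obtain ⟨-, rfl⟩ := mem_level_zero.1 hq
      exact Or.inr (Or.inr (Or.inr ⟨(a, a), hq, rfl⟩))
  · rintro (⟨c, q, hq, rfl⟩ | (⟨_, ⟨⟨a, b⟩, hq, rfl⟩, rfl⟩ | ⟨c, _, ⟨⟨a, b⟩, hq, rfl⟩, rfl⟩) |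
      (⟨_, ⟨⟨a, b⟩, hq, rfl⟩, rfl⟩ | ⟨⟨a, b⟩, hq, rfl⟩))
    · exact ⟨key.2 (Or.inl ⟨c, q, hq.1, rfl⟩), hq.2⟩
    · exact ⟨key.2 (Or.inr (Or.inl (Or.inl
        ⟨(1 :: a, 1 :: b), mem_level_cons_self.2 ⟨one_pos, hq⟩, rfl⟩))), rfl⟩
    · exact ⟨key.2 (Or.inr (Or.inl (Or.inr
        ⟨c, (1 :: a, 1 :: b), mem_level_cons_self.2 ⟨one_pos, hq⟩, rfl⟩))), rfl⟩
    · exact ⟨key.2 (Or.inr (Or.inr ⟨_, Or.inl ⟨(a, b), hq, rfl⟩, rfl⟩)), rfl⟩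
    · obtain ⟨-, rfl⟩ := mem_level_zero.1 hq
      exact ⟨key.2 (Or.inr (Or.inr ⟨_, Or.inr ⟨0, (a, a), hq, rfl⟩, rfl⟩)), rfl⟩

theorem gf_levelOneSecond : gf (levelOneSecond K) * (1 - PowerSeries.X) =
    PowerSeries.X * gf (levelOneHead K) + PowerSeries.X ^ 3 * gf (level K 0) +
      (1 - PowerSeries.X) * (PowerSeries.X ^ 2 + PowerSeries.X ^ 3) * gf (level K 0) := by
  have hbal : ∀ p ∈ levelOneSecond K, Balanced p.1 p.2 := fun p hp => hp.1.1
  rw [levelOneSecond_eq] at hbal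
  have hD : ∀ p ∈ (fun p : List ℕ × List ℕ => (1 :: p.1, 1 :: p.2)) '' level K 0,
      Balanced p.1 p.2 := by
    rintro _ ⟨p, hp, rfl⟩
    exact balanced_cons_self.2 ⟨one_pos, hp.1⟩
  have h1 := gf_prefixFamily (levelOneHead_balanced (K := K))
  have h2 := gf_half_union_small one_pos hD
  have h3 : gf ((fun p : List ℕ × List ℕ => (1 :: p.1, 1 :: p.2)) '' level K 0) =
      PowerSeries.X ^ 1 * gf (level K 0) := gf_image (by
      rintro ⟨a, b⟩ - ⟨a', b'⟩ - h
      simpa using h) 1 fun p _ => by rw [List.sum_cons]; ring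
  have h4 : gf (Prod.swap '' halfFamily 1 (level K 0)) = PowerSeries.X ^ (2 * 1) * gf (level K 0) :=
    (gf_swap (halfFamily_balanced one_pos (level_balanced 0))).trans (gf_halfFamily 1 _)
  have h5 : gf ((fun p : List ℕ × List ℕ => (3 :: p.1, 1 :: 1 :: 1 :: p.2)) '' level K 0) =
      PowerSeries.X ^ 3 * gf (level K 0) := gf_image (by
      rintro ⟨a, b⟩ - ⟨a', b'⟩ - h
      simpa using h) 3 fun p _ => by rw [List.sum_cons]; ring
  rw [levelOneSecond_eq, gf_union (fun p hp => hbal p (Or.inl hp))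
    (fun p hp => hbal p (Or.inr hp)) ?_,
    gf_union (fun p hp => hbal p (Or.inr (Or.inl hp)))
      (fun p hp => hbal p (Or.inr (Or.inr hp))) ?_,
    gf_union (fun p hp => hbal p (Or.inr (Or.inr (Or.inl hp))))
      (fun p hp => hbal p (Or.inr (Or.inr (Or.inr hp)))) ?_, h4, h5]
  · rw [h3] at h2
    linear_combination h1 + h2
  · rintro _ ⟨_, ⟨p, -, rfl⟩, rfl⟩ ⟨q, -, h⟩
    have := (List.cons.inj (Prod.mk.inj h).1).1
    omega
  · rintro _ (⟨p, -, rfl⟩ | ⟨c, p, -, rfl⟩) (⟨_, ⟨q, -, rfl⟩, h⟩ | ⟨q, -, h⟩)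
    all_goals
      have := (List.cons.inj (Prod.mk.inj h).1).1
      omega
  · rintro _ ⟨c, p, -, rfl⟩
      ((⟨q, -, h⟩ | ⟨c', q, -, h⟩) | (⟨_, ⟨q, -, rfl⟩, h⟩ | ⟨q, -, h⟩))
    all_goals
      have h6 := (List.cons.inj (Prod.mk.inj h).1).1
      have h7 := (List.cons.inj (Prod.mk.inj h).2).1
      omega

/-- The pairs of defect one with `b₁ = a₁ + 1` are `1|1|a / 2|a`. -/
theorem levelOneSucc_eq : levelOneSucc K = halfFamily 1 (level K 0) := by
  ext p
  have key := Set.ext_iff.1 (level_eq (K := K) one_ne_zero) p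
  rw [lower_one] at key
  constructor
  · rintro ⟨h, hb⟩
    rcases key.1 h with ⟨c, q, hq, rfl⟩ | (h | ⟨c, q, hq, rfl⟩) |
      ⟨_, ⟨q, hq, rfl⟩ | ⟨c, q, hq, rfl⟩, rfl⟩
    · exact absurd hb (Nat.succ_ne_self _)
    · exact h
    · simp only [List.headI_cons] at hb
      omega
    · simp only [Prod.swap_prod_mk, List.headI_cons] at hb
      omega
    · simp only [Prod.swap_prod_mk, List.headI_cons] at hb
      omega
  · intro h
    refine ⟨key.2 (Or.inr (Or.inl (Or.inl h))), ?_⟩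
    obtain ⟨q, -, rfl⟩ := h
    rfl

theorem gf_lower_two : gf (lower K 2) * (1 - PowerSeries.X) =
    PowerSeries.X ^ 4 * gf (level K 0) + PowerSeries.X * (1 - PowerSeries.X) *
      (gf (levelOneHead K) + gf (levelOneSecond K) + PowerSeries.X ^ 2 * gf (level K 0)) := by
  have hbal := lower_balanced (K := K) 2
  rw [lower_two] at hbal
  have h1 := gf_half_union_small two_pos (level_balanced (K := K) 0)
  have h2 : gf (bumpRight '' levelOneHead K) = PowerSeries.X ^ 1 * gf (levelOneHead K) :=
    gf_image (by
      rintro ⟨a, b⟩ ⟨-, hb⟩ ⟨a', b'⟩ ⟨-, hb'⟩ h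
      obtain ⟨b, rfl⟩ := exists_eq_cons_of_headI_eq_one hb
      obtain ⟨b', rfl⟩ := exists_eq_cons_of_headI_eq_one hb'
      simpa [bumpRight] using h) 1 fun p _ => by rw [bumpRight, List.sum_cons]; ring
  have h3 : gf (mergeRight '' levelOneSecond K) = PowerSeries.X ^ 1 * gf (levelOneSecond K) :=
    gf_image (by
      rintro ⟨a, b⟩ ⟨-, hb⟩ ⟨a', b'⟩ ⟨-, hb'⟩ h
      obtain ⟨c, b, rfl⟩ := exists_eq_cons_of_tail_headI_eq_one hb
      obtain ⟨c', b', rfl⟩ := exists_eq_cons_of_tail_headI_eq_one hb'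
      simpa [mergeRight] using h) 1 fun p _ => by rw [mergeRight, List.sum_cons]; ring
  have h4 : gf (bumpBoth '' levelOneSucc K) =
      PowerSeries.X ^ 1 * (PowerSeries.X ^ (2 * 1) * gf (level K 0)) := by
    rw [levelOneSucc_eq, ← gf_halfFamily]
    refine gf_image ?_ 1 fun p _ => ?_
    · rintro _ ⟨⟨a, b⟩, -, rfl⟩ _ ⟨⟨a', b'⟩, -, rfl⟩ h
      simpa [bumpBoth] using h
    · rw [bumpBoth, List.sum_cons, ← List.headI_add_tail_sum p.1]
      ring
  rw [lower_two, gf_union (fun p hp => hbal p (Or.inl hp)) (fun p hp => hbal p (Or.inr hp)) ?_,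
    gf_union (fun p hp => hbal p (Or.inr (Or.inl hp)))
      (fun p hp => hbal p (Or.inr (Or.inr hp))) ?_,
    gf_union (fun p hp => hbal p (Or.inr (Or.inr (Or.inl hp))))
      (fun p hp => hbal p (Or.inr (Or.inr (Or.inr hp)))) ?_, h2, h3, h4]
  · linear_combination h1
  · rintro _ ⟨p, -, rfl⟩ ⟨q, hq, h⟩
    rw [levelOneSucc_eq] at hq
    obtain ⟨q, -, rfl⟩ := hq
    have := (List.cons.inj (Prod.mk.inj h).1).1
    simp only [List.headI_cons] at this
    omega
  · rintro _ ⟨p, hp, rfl⟩ (⟨q, ⟨hq, hq'⟩, h⟩ | ⟨q, hq, h⟩)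
    · have h5 := (List.cons.inj (Prod.mk.inj h).2).1
      obtain ⟨c, t, hc⟩ := exists_eq_cons_of_tail_headI_eq_one hq'
      have h6 : 0 < c := hq.1.right_pos c (by rw [hc]; exact List.mem_cons_self ..)
      rw [hp.2, hc] at h5
      simp only [List.headI_cons, List.tail_cons] at h5
      omega
    · rw [levelOneSucc_eq] at hq
      obtain ⟨q, -, rfl⟩ := hq
      have := (List.cons.inj (Prod.mk.inj h).1).1
      simp only [List.headI_cons] at this
      omega
  · -- the first parts distinguish `m = 2` from `m = 1`
    have h8 : ∀ p ∈ halfFamily 2 (level K 0) ∪ smallFamily 2 (level K 0),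
        p.1.headI = 2 ∧ 4 ≤ p.2.headI := by
      rintro _ (⟨p, -, rfl⟩ | ⟨c, p, -, rfl⟩)
      · exact ⟨rfl, le_rfl⟩
      · refine ⟨rfl, ?_⟩
        simp only [List.headI_cons]
        omega
    rintro p hp (⟨q, hq, rfl⟩ | ⟨q, hq, rfl⟩ | ⟨q, hq, rfl⟩)
    · exact absurd (h8 _ hp).1 (by simp [bumpRight])
    · exact absurd (h8 _ hp).1 (by simp [mergeRight])
    · have := (h8 _ hp)
      have h9 := hq.2
      simp only [bumpBoth, List.headI_cons] at this
      omega

/-- The generating function of the pairs of defect two, from the linear equations for the families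
above. -/
theorem gf_level_two : gf (level K 2) * (1 - 2 * PowerSeries.X) ^ 3 =
    6 * PowerSeries.X ^ 3 - 10 * PowerSeries.X ^ 4 - 4 * PowerSeries.X ^ 5
      + 10 * PowerSeries.X ^ 6 - 4 * PowerSeries.X ^ 7 := by
  have hu : (1 - PowerSeries.X : ℚ⟦X⟧) ≠ 0 := fun h => by
    simpa using congrArg PowerSeries.constantCoeff h
  have h0 := gf_level_zero (K := K)
  have h1 := gf_lower_one (K := K)
  have h2 := gf_level (K := K) one_ne_zero
  have h3 := gf_levelOneHead (K := K)
  have h4 := gf_levelOneSecond (K := K)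
  have h5 := gf_lower_two (K := K)
  have h6 := gf_level (K := K) two_ne_zero
  set S := gf (level K 0)
  set L₁ := gf (lower K 1)
  set F₁ := gf (level K 1)
  set G₁ := gf (levelOneHead K)
  set G₂ := gf (levelOneSecond K)
  set L₂ := gf (lower K 2)
  set F₂ := gf (level K 2)
  set x : ℚ⟦X⟧ := PowerSeries.X
  have e1 : L₁ * (1 - 2 * x) = x ^ 2 := mul_right_cancel₀ hu (by
    linear_combination (1 - 2 * x) * h1 + x ^ 2 * h0)
  have e2 : F₁ * (1 - 2 * x) ^ 2 = 2 * x ^ 2 * (1 - x) := by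
    linear_combination (1 - 2 * x) * h2 + 2 * (1 - x) * e1
  have e3 : G₁ * (1 - 2 * x) ^ 2 = 2 * x ^ 3 * (1 - x) + x ^ 2 * (1 - 2 * x) := by
    linear_combination (1 - 2 * x) ^ 2 * h3 + x * e2 + (1 - 2 * x) * e1
  have e4 : G₂ * (1 - x) * (1 - 2 * x) ^ 2 =
      x * (2 * x ^ 3 * (1 - x) + x ^ 2 * (1 - 2 * x)) + x ^ 3 * (1 - x) * (1 - 2 * x) +
        (1 - x) ^ 2 * (x ^ 2 + x ^ 3) * (1 - 2 * x) := by
    linear_combination (1 - 2 * x) ^ 2 * h4 + x * e3 +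
      (x ^ 3 + (1 - x) * (x ^ 2 + x ^ 3)) * (1 - 2 * x) * h0
  linear_combination (1 - 2 * x) ^ 2 * h6 + 2 * (1 - 2 * x) ^ 2 * h5 +
    2 * (x ^ 4 + x ^ 3 * (1 - x)) * (1 - 2 * x) * h0 + 2 * x * (1 - x) * e3 + 2 * x * e4

/-- The pairs counted by `C(n, n - 3)` are the pairs of defect two. -/
theorem numPairs_eq_ncard {n : ℕ} (hn : 0 < n) :
    numPairs K n ((n : ℤ) - 3) = (level K 2 ∩ {p | p.1.sum = n}).ncard := by
  let f : Composition n × Composition n → List ℕ × List ℕ := fun p => (p.1.blocks, p.2.blocks)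
  have hf : Function.Injective f := fun p q h =>
    Prod.ext (Composition.ext (Prod.mk.inj h).1) (Composition.ext (Prod.mk.inj h).2)
  have key : ∀ p : Composition n × Composition n,
      (index K (seaweed K p.1 p.2) : ℤ) = (n : ℤ) - 3 ↔ f p ∈ level K 2 := by
    intro p
    have hb : Balanced p.1.blocks p.2.blocks := ⟨fun i hi => p.1.blocks_pos hi,
      fun i hi => p.2.blocks_pos hi, p.1.blocks_sum.trans p.2.blocks_sum.symm⟩
    have h1 := index_seaweed_add_one (K := K) hn p.1 p.2
    have h2 := glIndex_le K hb
    have h3 : f p ∈ level K 2 ↔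
        p.1.blocks.sum - glIndex K p.1.blocks.sum p.1.blocks p.2.blocks = 2 :=
      ⟨fun h => h.2, fun h => ⟨hb, h⟩⟩
    rw [p.1.blocks_sum] at h2 h3
    rw [h3]
    omega
  have himage : level K 2 ∩ {p | p.1.sum = n} =
      f '' {p | (index K (seaweed K p.1 p.2) : ℤ) = (n : ℤ) - 3} := by
    ext ⟨a, b⟩
    constructor
    · rintro ⟨hp, hs⟩
      have h := hp.1
      let q : Composition n × Composition n := (⟨a, fun {i} hi => h.left_pos i hi, hs⟩,
        ⟨b, fun {i} hi => h.right_pos i hi, h.sum_eq.symm.trans hs⟩)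
      exact ⟨q, (key q).2 hp, rfl⟩
    · rintro ⟨q, hq, hab⟩
      rw [← hab]
      exact ⟨(key q).1 hq, q.1.blocks_sum⟩
  rw [himage, Set.ncard_image_of_injective _ hf]
  rfl

end LevelTwo

end Seaweed

theorem mainTheorem5 (K : Type*) [Field K] [IsAlgClosed K] [CharZero K] :
    (PowerSeries.mk fun n : ℕ =>
        if 0 < n then (Seaweed.numPairs K n ((n : ℤ) - 3) : ℚ) else 0) =
      (6 * PowerSeries.X ^ 3 - 10 * PowerSeries.X ^ 4 - 4 * PowerSeries.X ^ 5
          + 10 * PowerSeries.X ^ 6 - 4 * PowerSeries.X ^ 7 : ℚ⟦X⟧)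
        * ((1 - 2 * PowerSeries.X : ℚ⟦X⟧) ^ 3)⁻¹ := by
  have hgf : (PowerSeries.mk fun n : ℕ =>
      if 0 < n then (Seaweed.numPairs K n ((n : ℤ) - 3) : ℚ) else 0) =
      Seaweed.gf (Seaweed.level K 2) := by
    ext n
    rw [Seaweed.gf, PowerSeries.coeff_mk, PowerSeries.coeff_mk]
    split_ifs with hn
    · rw [Seaweed.numPairs_eq_ncard hn]
    · -- a pair of empty lists has defect zero
      obtain rfl : n = 0 := by omega
      rw [Set.eq_empty_of_forall_notMem (s := Seaweed.level K 2 ∩ {p | p.1.sum = 0}) fun p hp => ?_,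
        Set.ncard_empty, Nat.cast_zero]
      have h1 : p.1.sum - Seaweed.glIndex K p.1.sum p.1 p.2 = 2 := hp.1.2
      have h2 : p.1.sum = 0 := hp.2
      omega
  rw [hgf, PowerSeries.eq_mul_inv_iff_mul_eq (by simp)]
  exact Seaweed.gf_level_two
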